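/- **Notation.** All functions are real-valued functions on $\mathbb{R}$; $\hat u(\xi)=\int_{\mathbb R} e^{-ix\xi}u(x)\,dx$ denotes the Fourier transform on $L^2(\mathbb{R})$; $f_x=\partial_x f$; $\langle a\rangle=\sqrt{1+a^2}$; $\Vert\cdot\Vert_{L^2}$ is the norm of $L^2(\mathbb{R},dx)$. For $\sigma\ge 0$, $\lambda>0$ and $\alpha\neq 0$ put $$\Vert u\Vert_{\dot H^\sigma}^2=\frac1{2\pi}\int_{\mathbb R}|\xi|^{2\sigma}|\hat u(\xi)|^2\,d\xi,\qquad \Vert u\Vert_{\dot H^{3/2}_\lambda}^2=\int_{\mathbb R}\min\{\lambda|\xi|,1\}^{\frac1{100}}|\xi|^{3}|\hat u(\xi)|^2\,d\xi,\qquad \Delta_\alpha u(x)=\frac{u(x)-u(x-\alpha)}{\alpha},$$ and let $H^{3/2}(\mathbb{R})=\{u\in L^2(\mathbb{R}) : \int_{\mathbb R}(1+|\xi|)^3|\hat u(\xi)|^2\,d\xi<\infty\}$. For functions $f,g$ in $H^{3/2}(\mathbb{R})\cap C^\infty(\mathbb{R})$, the remainder $R(f)g$ is the function $$R(f)g(x)=-\frac1\pi\,\mathrm{pv}\!\!\int_{\mathbb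 R}(\partial_x\Delta_\alpha g)(x)\left(\mathcal E(\alpha,x)-\frac{f_x(x)^2}{1+f_x(x)^2}\right)d\alpha+\frac1\pi\int_{\mathbb R}\frac{g_x(x-\alpha)}{\alpha}\,\mathcal O(\alpha,x)\,d\alpha,$$ where $\mathrm{pv}\!\int_{\mathbb R}=\lim_{N\to\infty}\int_{-N}^{N}$ and $$\mathcal O(\alpha,x)=\frac12\frac{(\Delta_\alpha f(x))^2}{1+(\Delta_\alpha f(x))^2}-\frac12\frac{(\Delta_{-\alpha} f(x))^2}{1+(\Delta_{-\alpha} f(x))^2},\qquad \mathcal E(\alpha,x)=\frac12\frac{(\Delta_\alpha f(x))^2}{1+(\Delta_\alpha f(x))^2}+\frac12\frac{(\Delta_{-\alpha} f(x))^2}{1+(\Delta_{-\alpha} f(x))^2}.$$ **Proposition.** There is an absolute constant $C>0$ such that, for every $\lambda>0$, all $f,g\in H^{3/2}(\mathbb{R})\cap C^\infty(\mathbb{R})$ and all $h\in L^2(\mathbb{R})$, the following holds. For every $x\in\mathbb R$ the integrals defining $R(f)g(x)$ converge (the first as a principal value at infinity, its integrand being integrable on each $[-N,N]$; the second absolutely),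 the function $R(f)g\cdot h$ is integrable, and, with $\langle R(f)g,h\rangle=\int_{\mathbb R}R(f)g(x)\,h(x)\,dx$, $$\left|\langle R(f)g,h\rangle\right|\le C\left[\left(1+\Vert f\Vert_{\dot H^{3/2}}^2\right)\Vert f\Vert_{\dot H^{3/2}_\lambda}\left\Vert\frac{g_x}{\langle f_x\rangle}\right\Vert_{L^2}\left\Vert\frac{h}{\langle f_x\rangle}\right\Vert_{L^2}+\frac1{\sqrt\lambda}\,\Vert g\Vert_{\dot H^{1/2}}\,\Vert f\Vert_{\dot H^{3/2}}\,\Vert h\Vert_{L^2}\right].$$ -/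

import Mathlib

open MeasureTheory Filter Topology
open scoped FourierTransform ContDiff

noncomputable section

namespace Muskat

/-- The Fourier transform of a real-valued function `u ∈ L²(ℝ)`, with the normalization
`û(ξ) = ∫ e^{-ixξ} u(x) dx`: it is the unitary `L²` Fourier transform of Mathlib (whose kernel is
`e^{-2πixξ}`) evaluated at `ξ / 2π`. Set to `0` when `u` is not in `L²`. -/
def fourierL2 (u : ℝ → ℝ) : ℝ → ℂ :=
  open Classical in
  if hu : MemLp (fun x => (u x : ℂ)) 2 volume then
    fun ξ => ((𝓕 (hu.toLp (fun x => (u x : ℂ))) : Lp ℂ 2 (volume : Measure ℝ)) : ℝ → ℂ)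
      (ξ / (2 * Real.pi))
  else 0

/-- `u ∈ H^s(ℝ)`: `u ∈ L²` and `∫ (1 + |ξ|)^{2s} |û(ξ)|² dξ < ∞`. -/
def MemH (s : ℝ) (u : ℝ → ℝ) : Prop :=
  MemLp u 2 volume ∧
    Integrable (fun ξ : ℝ => (1 + |ξ|) ^ (2 * s) * ‖fourierL2 u ξ‖ ^ 2) volume

/-- The homogeneous norm `‖u‖_{Ḣ^σ} = ((2π)⁻¹ ∫ |ξ|^{2σ} |û(ξ)|² dξ)^{1/2}`. -/
def homNorm (σ : ℝ) (u : ℝ → ℝ) : ℝ :=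
  Real.sqrt ((2 * Real.pi)⁻¹ * ∫ ξ : ℝ, |ξ| ^ (2 * σ) * ‖fourierL2 u ξ‖ ^ 2)

/-- The norm `‖u‖_{Ḣ^{3/2}_lam} = (∫ min{lam |ξ|, 1}^{1/100} |ξ|³ |û(ξ)|² dξ)^{1/2}`. -/
def homNormTrunc (lam : ℝ) (u : ℝ → ℝ) : ℝ :=
  Real.sqrt (∫ ξ : ℝ, (min (lam * |ξ|) 1) ^ (1 / 100 : ℝ) * |ξ| ^ 3 * ‖fourierL2 u ξ‖ ^ 2)

/-- The `L²(ℝ)` norm. -/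
def normL2 (u : ℝ → ℝ) : ℝ := (eLpNorm u 2 volume).toReal

/-- The bracket `⟨a⟩ = √(1 + a²)`. -/
def bracket (a : ℝ) : ℝ := Real.sqrt (1 + a ^ 2)

/-- The slope `Δ_α f(x) = (f(x) - f(x - α)) / α`. -/
def slope (α : ℝ) (f : ℝ → ℝ) (x : ℝ) : ℝ := (f x - f (x - α)) / α

/-- The odd part in `α` of `(Δ_α f)² / (1 + (Δ_α f)²)`. -/
def oddPart (f : ℝ → ℝ) (α x : ℝ) : ℝ :=
  1 / 2 * (slope α f x ^ 2 / (1 + slope α f x ^ 2))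
    - 1 / 2 * (slope (-α) f x ^ 2 / (1 + slope (-α) f x ^ 2))

/-- The even part in `α` of `(Δ_α f)² / (1 + (Δ_α f)²)`. -/
def evenPart (f : ℝ → ℝ) (α x : ℝ) : ℝ :=
  1 / 2 * (slope α f x ^ 2 / (1 + slope α f x ^ 2))
    + 1 / 2 * (slope (-α) f x ^ 2 / (1 + slope (-α) f x ^ 2))

/-- The first integrand `(∂ₓ Δ_α g) (E(α, x) - (∂ₓ f)² / (1 + (∂ₓ f)²))` of `R(f)g`. -/
def integrandE (f g : ℝ → ℝ) (x α : ℝ) : ℝ :=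
  deriv (slope α g) x * (evenPart f α x - deriv f x ^ 2 / (1 + deriv f x ^ 2))

/-- The second integrand `(∂ₓ g(x - α) / α) O(α, x)` of `R(f)g`. -/
def integrandO (f g : ℝ → ℝ) (x α : ℝ) : ℝ :=
  deriv g (x - α) / α * oddPart f α x

/-- The integrals that define `R(f)g(x)` make sense. The first one converges only as a principal
value at infinity, because `integrandE f g x α` in general behaves like a constant times `1 / α`
when `|α| → ∞`. The second one converges absolutely. -/
def RemainderConverges (f g : ℝ → ℝ) (x : ℝ) : Prop :=
  (∀ N : ℝ, IntervalIntegrable (integrandE f g x) volume (-N) N) ∧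
  (∃ l : ℝ, Tendsto (fun N : ℝ => ∫ α in (-N)..N, integrandE f g x α) atTop (𝓝 l)) ∧
  Integrable (integrandO f g x) volume

/-- The remainder
`R(f)g(x) = -π⁻¹ pv ∫ (∂ₓ Δ_α g(x)) (E(α, x) - (∂ₓ f)² / (1 + (∂ₓ f)²)) dα
  + π⁻¹ ∫ (∂ₓ g(x - α) / α) O(α, x) dα`. -/
def remainder (f g : ℝ → ℝ) (x : ℝ) : ℝ :=
  -(1 / Real.pi) * limUnder atTop (fun N : ℝ => ∫ α in (-N)..N, integrandE f g x α)
    + 1 / Real.pi * ∫ α, integrandO f g x α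

end Muskat

end

noncomputable section

namespace Muskat

/-! Write `s(t) = t² / (1 + t²)`. Since `∂ₓ Δ_α g(x) = (g_x(x) - g_x(x - α)) / α`, the term with
`g_x(x)` is odd in `α` and integrates to zero over `[-N, N]`; what is left of the two integrals
recombines, and `π R(f)g(x)` is the single absolutely convergent integral of `g_x(x - α) / α *
(s(Δ_α f(x)) - s(f_x(x)))` (`remainder_eq`). It is split at `|α| = λ`.

For `|α| ≤ λ`, the decay of `s'` pays for both weights: `⟨f_x(x)⟩ ⟨f_x(x - α)⟩ |s(Δ_α f) - s(f_x)|`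
is at most `2 |w| (1 + |z|)`, where `w = Δ_α f(x) - f_x(x)` and `z` is the same deviation seen from
the point `x - α` (`bracket_mul_abs_saturation_sub_le`). Cauchy-Schwarz in `(x, α)` separates the
weighted `g_x` and `h` from `w² + w⁴ + z⁴` integrated against `dα / α²`. By Plancherel the square of
`w` yields `|ξ|³ min(λ|ξ|, 1)`; the fourth powers follow from the Gagliardo-Nirenberg inequality
`‖v‖₄⁴ ≲ ‖v‖₂² ‖v‖²_{Ḣ^{1/2}}` and cost one more factor `‖f‖²_{Ḣ^{3/2}}`.

For `|α| > λ`, integration by parts in `α` moves the derivative off `g`, using `g_x(x - α) = ∂_α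
(g(x) - g(x - α))`. The same Gagliardo-Nirenberg inequality bounds the `L⁴` norms of `g - g(· - α)`
and of the deviation of `f` by `|α|^{1/4}` times `‖g‖_{Ḣ^{1/2}}` and `‖f‖_{Ḣ^{3/2}}`. Hölder with
exponents 4, 4, 2 gives `|α|^{1/2}`, and `∫_λ^∞ α^{-3/2} dα = 2 λ^{-1/2}`; the boundary term has the
same size. -/

/-! ### Translations, Fourier symbols and Plancherel on `L²`. -/

/-- Multiplication by a unimodular character on `L²`, the Fourier side of a translation. -/
def modulate (a : ℝ) (F : Lp ℂ 2 (volume : Measure ℝ)) : Lp ℂ 2 (volume : Measure ℝ) :=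
  MemLp.toLp (fun η : ℝ => Complex.exp (-(2 * Real.pi * a * η : ℝ) * Complex.I) * F η) (by
    refine (Lp.memLp F).of_le ?_ (ae_of_all _ fun η => ?_)
    · exact (by fun_prop : Continuous fun η : ℝ =>
        Complex.exp (-(2 * Real.pi * a * η : ℝ) * Complex.I)).aestronglyMeasurable.mul
          (Lp.aestronglyMeasurable F)
    · rw [norm_mul, ← Complex.ofReal_neg, Complex.norm_exp_ofReal_mul_I, one_mul])

theorem modulate_coeFn (a : ℝ) (F : Lp ℂ 2 (volume : Measure ℝ)) :
    modulate a F =ᵐ[volume]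
      fun η : ℝ => Complex.exp (-(2 * Real.pi * a * η : ℝ) * Complex.I) * F η :=
  MemLp.coeFn_toLp _

theorem isometry_modulate (a : ℝ) : Isometry (modulate a) := by
  intro F G
  rw [modulate, modulate, Lp.edist_toLp_toLp, Lp.edist_def]
  refine eLpNorm_congr_norm_ae (ae_of_all _ fun η => ?_)
  simp only [Pi.sub_apply]
  rw [← mul_sub, norm_mul, ← Complex.ofReal_neg, Complex.norm_exp_ofReal_mul_I, one_mul]

/-- Both sides are continuous in `F`, being compositions of isometries, so it is enough to treat
Schwartz functions, where the Fourier transform is an integral and a change of variables applies. -/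
theorem fourier_compMeasurePreserving_sub (a : ℝ) (F : Lp ℂ 2 (volume : Measure ℝ)) :
    𝓕 (Lp.compMeasurePreserving (fun x : ℝ => x - a) (measurePreserving_sub_right volume a) F)
      = modulate a (𝓕 F) := by
  refine DenseRange.induction_on (p := fun F : Lp ℂ 2 (volume : Measure ℝ) =>
    𝓕 (Lp.compMeasurePreserving (fun x : ℝ => x - a) (measurePreserving_sub_right volume a) F)
      = modulate a (𝓕 F))
    (SchwartzMap.denseRange_toLpCLM (E := ℝ) (F := ℂ) (p := 2) (μ := volume)
      ENNReal.ofNat_ne_top) F ?_ ?_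
  · apply isClosed_eq
    · exact (Lp.fourierTransformₗᵢ ℝ ℂ).continuous.comp
        (Lp.isometry_compMeasurePreserving (measurePreserving_sub_right volume a)).continuous
    · exact (isometry_modulate a).continuous.comp (Lp.fourierTransformₗᵢ ℝ ℂ).continuous
  · intro ψ
    rw [SchwartzMap.toLpCLM_apply]
    have h1 : Lp.compMeasurePreserving (fun x : ℝ => x - a) (measurePreserving_sub_right volume a)
        (ψ.toLp 2 volume) = (ψ.compSubConstCLM ℂ a).toLp 2 volume := by
      apply Lp.ext
      filter_upwards [Lp.coeFn_compMeasurePreserving (ψ.toLp 2 volume)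
        (measurePreserving_sub_right volume a), (ψ.compSubConstCLM ℂ a).coeFn_toLp 2 volume,
        (measurePreserving_sub_right volume a).quasiMeasurePreserving.ae (ψ.coeFn_toLp 2 volume)]
        with x h1 h2 h3
      rw [h1, h2, Function.comp_apply, h3, SchwartzMap.compSubConstCLM_apply]
    rw [h1, SchwartzMap.toLp_fourier_eq, SchwartzMap.toLp_fourier_eq]
    apply Lp.ext
    filter_upwards [modulate_coeFn a ((𝓕 ψ).toLp 2 volume), (𝓕 ψ).coeFn_toLp 2 volume,
      (𝓕 (ψ.compSubConstCLM ℂ a)).coeFn_toLp 2 volume] with η h1 h2 h3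
    rw [h1, h2, h3, SchwartzMap.fourier_coe, SchwartzMap.fourier_coe]
    rw [Real.fourier_real_eq_integral_exp_smul, Real.fourier_real_eq_integral_exp_smul,
      ← integral_sub_right_eq_self _ (-a), ← integral_const_mul]
    refine integral_congr_ae (ae_of_all _ fun x => ?_)
    simp only [SchwartzMap.compSubConstCLM_apply, smul_eq_mul, sub_neg_eq_add, add_sub_cancel_right]
    rw [← mul_assoc, ← Complex.exp_add]
    congr 2
    push_cast
    ring

/-- `φ` is the Fourier transform `∫ e^{-ixξ} v(x) dx` of the real function `v ∈ L²`. -/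
def HasSpectrum (v : ℝ → ℝ) (φ : ℝ → ℂ) : Prop :=
  ∃ hv : MemLp (fun x => (v x : ℂ)) 2 volume,
    (fun ξ => ((𝓕 (hv.toLp (fun x => (v x : ℂ))) : Lp ℂ 2 (volume : Measure ℝ)) : ℝ → ℂ)
      (ξ / (2 * Real.pi))) =ᵐ[volume] φ

theorem memLp_ofReal {v : ℝ → ℝ} (hv : MemLp v 2 volume) :
    MemLp (fun x => (v x : ℂ)) 2 volume := hv.ofReal

theorem hasSpectrum_fourierL2 {v : ℝ → ℝ} (hv : MemLp v 2 volume) :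
    HasSpectrum v (fourierL2 v) := by
  refine ⟨memLp_ofReal hv, ?_⟩
  rw [fourierL2, dif_pos (memLp_ofReal hv)]

theorem measurable_fourierL2 (v : ℝ → ℝ) : Measurable (fourierL2 v) := by
  unfold fourierL2
  split_ifs with hv
  · exact (Lp.stronglyMeasurable _).measurable.comp (measurable_id.div_const _)
  · exact measurable_const

theorem quasiMeasurePreserving_div_two_pi :
    Measure.QuasiMeasurePreserving (fun ξ : ℝ => ξ / (2 * Real.pi)) volume volume := by
  have h : (2 * Real.pi)⁻¹ ≠ 0 := by positivity
  refine ⟨by fun_prop, ?_⟩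
  simp_rw [div_eq_mul_inv]
  rw [Real.map_volume_mul_right h]
  exact Measure.smul_absolutelyContinuous

theorem HasSpectrum.sub {u v : ℝ → ℝ} {φ ψ : ℝ → ℂ} (hu : HasSpectrum u φ)
    (hv : HasSpectrum v ψ) : HasSpectrum (fun x => u x - v x) (fun ξ => φ ξ - ψ ξ) := by
  obtain ⟨mu, eu⟩ := hu
  obtain ⟨mv, ev⟩ := hv
  have hm : MemLp (fun x => ((u x - v x : ℝ) : ℂ)) 2 volume := by
    refine (mu.sub mv).ae_eq (ae_of_all _ fun x => ?_)
    simp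
  refine ⟨hm, ?_⟩
  have h1 : hm.toLp _ = mu.toLp _ - mv.toLp _ := by
    rw [← MemLp.toLp_sub]
    exact MemLp.toLp_congr _ _ (ae_of_all _ fun x => by simp)
  have h2 : (𝓕 (hm.toLp _) : Lp ℂ 2 (volume : Measure ℝ)) = 𝓕 (mu.toLp _) - 𝓕 (mv.toLp _) := by
    rw [h1]
    exact (Lp.fourierTransformₗᵢ ℝ ℂ).map_sub _ _
  have h3 := quasiMeasurePreserving_div_two_pi.ae (Lp.coeFn_sub
    (𝓕 (mu.toLp _) : Lp ℂ 2 (volume : Measure ℝ)) (𝓕 (mv.toLp _)))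
  filter_upwards [eu, ev, h3] with ξ a b c
  rw [h2, c, Pi.sub_apply, a, b]

theorem HasSpectrum.const_mul {v : ℝ → ℝ} {φ : ℝ → ℂ} (hv : HasSpectrum v φ) (c : ℝ) :
    HasSpectrum (fun x => c * v x) (fun ξ => c * φ ξ) := by
  obtain ⟨mv, ev⟩ := hv
  have hm : MemLp (fun x => ((c * v x : ℝ) : ℂ)) 2 volume := by
    simpa using mv.const_mul (c : ℂ)
  refine ⟨hm, ?_⟩
  have h1 : hm.toLp _ = (c : ℂ) • mv.toLp _ := by
    rw [← MemLp.toLp_const_smul]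
    exact MemLp.toLp_congr _ _ (ae_of_all _ fun x => by simp)
  have h2 : (𝓕 (hm.toLp _) : Lp ℂ 2 (volume : Measure ℝ)) = (c : ℂ) • 𝓕 (mv.toLp _) := by
    rw [h1]
    exact (Lp.fourierTransformₗᵢ ℝ ℂ).map_smul _ _
  have h3 := quasiMeasurePreserving_div_two_pi.ae (Lp.coeFn_smul (c : ℂ)
    (𝓕 (mv.toLp _) : Lp ℂ 2 (volume : Measure ℝ)))
  filter_upwards [ev, h3] with ξ b c
  rw [h2, c, Pi.smul_apply, b, smul_eq_mul]

theorem HasSpectrum.translate {v : ℝ → ℝ} {φ : ℝ → ℂ} (hv : HasSpectrum v φ) (a : ℝ) :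
    HasSpectrum (fun x => v (x - a))
      (fun ξ => Complex.exp (-(a * ξ : ℝ) * Complex.I) * φ ξ) := by
  obtain ⟨mv, ev⟩ := hv
  have hm : MemLp (fun x => (v (x - a) : ℂ)) 2 volume :=
    mv.comp_measurePreserving (measurePreserving_sub_right volume a)
  refine ⟨hm, ?_⟩
  have h1 : hm.toLp _ = Lp.compMeasurePreserving (fun x : ℝ => x - a)
      (measurePreserving_sub_right volume a) (mv.toLp _) := by
    rw [Lp.toLp_compMeasurePreserving]
    rfl
  have h3 := quasiMeasurePreserving_div_two_pi.ae (modulate_coeFn a (𝓕 (mv.toLp _)))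
  filter_upwards [ev, h3] with ξ b c
  rw [h1, fourier_compMeasurePreserving_sub, c, b]
  congr 3
  push_cast
  field_simp

theorem HasSpectrum.plancherel {v : ℝ → ℝ} {φ : ℝ → ℂ} (hv : HasSpectrum v φ) :
    ∫⁻ x, ‖v x‖ₑ ^ 2 = ENNReal.ofReal (2 * Real.pi)⁻¹ * ∫⁻ ξ, ‖φ ξ‖ₑ ^ 2 := by
  obtain ⟨mv, ev⟩ := hv
  have key : ∀ F : Lp ℂ 2 (volume : Measure ℝ), ∫⁻ x, ‖F x‖ₑ ^ 2 = ‖F‖ₑ ^ 2 := by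
    intro F
    rw [Lp.enorm_def, eLpNorm_eq_lintegral_rpow_enorm_toReal two_ne_zero ENNReal.ofNat_ne_top,
      ← ENNReal.rpow_natCast, ← ENNReal.rpow_mul]
    simp
  have h1 : ∫⁻ x, ‖v x‖ₑ ^ 2 = ∫⁻ x, ‖(mv.toLp _ : Lp ℂ 2 (volume : Measure ℝ)) x‖ₑ ^ 2 := by
    refine lintegral_congr_ae ?_
    filter_upwards [mv.coeFn_toLp] with x hx
    rw [hx]
    simp [enorm_eq_nnnorm]
  have h2 : ∫⁻ ξ, ‖φ ξ‖ₑ ^ 2 = ∫⁻ ξ : ℝ,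
      ‖(𝓕 (mv.toLp _) : Lp ℂ 2 (volume : Measure ℝ)) (ξ / (2 * Real.pi))‖ₑ ^ 2 := by
    refine lintegral_congr_ae ?_
    filter_upwards [ev] with x hx
    rw [← hx]
  have hp : (2 * Real.pi)⁻¹ ≠ 0 := by positivity
  have h3 : ∫⁻ η, ‖(𝓕 (mv.toLp _) : Lp ℂ 2 (volume : Measure ℝ)) η‖ₑ ^ 2
      = ENNReal.ofReal (2 * Real.pi)⁻¹ * ∫⁻ ξ : ℝ,
      ‖(𝓕 (mv.toLp _) : Lp ℂ 2 (volume : Measure ℝ)) (ξ / (2 * Real.pi))‖ₑ ^ 2 := by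
    simp_rw [div_eq_mul_inv]
    rw [← lintegral_map (f := fun η : ℝ =>
      ‖(𝓕 (mv.toLp _) : Lp ℂ 2 (volume : Measure ℝ)) η‖ₑ ^ 2)
      ((Lp.stronglyMeasurable _).measurable.enorm.pow_const 2) (measurable_mul_const _),
      Real.map_volume_mul_right hp, lintegral_smul_measure, smul_eq_mul, ← mul_assoc,
      ← ENNReal.ofReal_mul (by positivity), abs_of_nonneg (by positivity),
      mul_inv_cancel₀ hp, ENNReal.ofReal_one, one_mul]
  rw [h2, ← h3, h1, key, key, ← ofReal_norm, ← ofReal_norm,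
    Lp.norm_fourier_eq]

/-! ### Square-function bounds for increments, slopes and derivatives. -/

/-- The spectral density `|û(ξ)|² / 2π`. -/
def density (u : ℝ → ℝ) (ξ : ℝ) : ENNReal :=
  ENNReal.ofReal (2 * Real.pi)⁻¹ * ‖fourierL2 u ξ‖ₑ ^ 2

@[fun_prop]
theorem measurable_density (u : ℝ → ℝ) : Measurable (density u) :=
  ((measurable_fourierL2 u).enorm.pow_const 2).const_mul _

/-- The squared `L²` norms of `v` and of its increments are dominated by the density `W`. -/
structure SpectrallyBounded (v : ℝ → ℝ) (W : ℝ → ENNReal) : Prop where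
  sq_le : ∫⁻ x, ‖v x‖ₑ ^ 2 ≤ ∫⁻ ξ, W ξ
  increment_le : ∀ s : ℝ, ∫⁻ x, ‖v x - v (x - s)‖ₑ ^ 2 ≤
    ∫⁻ ξ, ENNReal.ofReal (min 4 (s ^ 2 * ξ ^ 2)) * W ξ

theorem norm_one_sub_exp_sq_le (t : ℝ) :
    ‖1 - Complex.exp (-(t : ℝ) * Complex.I)‖ ^ 2 ≤ min 4 (t ^ 2) := by
  have h : (1 : ℂ) - Complex.exp (-(t : ℝ) * Complex.I)
      = -(Complex.exp (Complex.I * (-t : ℝ)) - 1) := by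
    rw [mul_comm Complex.I]; push_cast; ring
  rw [h, norm_neg, ]
  have h1 := Real.norm_exp_I_mul_ofReal_sub_one_le (x := -t)
  have h2 : ‖Complex.exp (Complex.I * (-t : ℝ)) - 1‖ ≤ 2 := by
    refine (norm_sub_le _ _).trans ?_
    rw [mul_comm, Complex.norm_exp_ofReal_mul_I]
    norm_num
  refine le_min ?_ ?_
  · nlinarith [norm_nonneg (Complex.exp (Complex.I * (-t : ℝ)) - 1)]
  · rw [Real.norm_eq_abs, abs_neg] at h1
    rw [← sq_abs t]
    gcongr

theorem HasSpectrum.lintegral_sq_le {u v : ℝ → ℝ} {m : ℝ → ℂ} {M : ℝ → ℝ}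
    (hv : HasSpectrum v fun ξ => m ξ * fourierL2 u ξ) (hm : ∀ ξ, ‖m ξ‖ ^ 2 ≤ M ξ) :
    ∫⁻ x, ‖v x‖ₑ ^ 2 ≤ ∫⁻ ξ, ENNReal.ofReal (M ξ) * density u ξ := by
  rw [hv.plancherel, ← lintegral_const_mul' _ _ ENNReal.ofReal_ne_top]
  refine lintegral_mono fun ξ => ?_
  rw [density, mul_left_comm, enorm_mul, mul_pow]
  gcongr
  rw [← ofReal_norm, ← ENNReal.ofReal_pow (norm_nonneg _)]
  exact ENNReal.ofReal_le_ofReal (hm ξ)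

theorem HasSpectrum.increment {u v : ℝ → ℝ} {m : ℝ → ℂ}
    (hv : HasSpectrum v fun ξ => m ξ * fourierL2 u ξ) (s : ℝ) :
    HasSpectrum (fun x => v x - v (x - s))
      fun ξ => ((1 - Complex.exp (-(s * ξ : ℝ) * Complex.I)) * m ξ) * fourierL2 u ξ := by
  convert! hv.sub (hv.translate s) using 2
  ring

/-- Fatou's lemma. -/
theorem lintegral_sq_le_of_tendsto {v : ℝ → ℝ} {w : ℕ → ℝ → ℝ} {A : ENNReal}
    (hw : ∀ n, Measurable (w n)) (hlim : ∀ x, Tendsto (fun n => w n x) atTop (𝓝 (v x)))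
    (hA : ∀ n, ∫⁻ x, ‖w n x‖ₑ ^ 2 ≤ A) : ∫⁻ x, ‖v x‖ₑ ^ 2 ≤ A := by
  have h1 : ∀ x, ‖v x‖ₑ ^ 2 = liminf (fun n => ‖w n x‖ₑ ^ 2) atTop := fun x =>
    (((ENNReal.continuous_pow 2).tendsto _).comp (hlim x).enorm).liminf_eq.symm
  simp_rw [h1]
  refine (lintegral_liminf_le fun n => (hw n).enorm.pow_const 2).trans ?_
  refine liminf_le_of_le (by isBoundedDefault) fun b hb => ?_
  obtain ⟨n, hn⟩ := hb.exists
  exact hn.trans (hA n)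

/-- Only a bound on the symbols uniform in `n` is needed, thanks to Fatou. This treats `u'` as a
pointwise limit of slopes, without identifying its Fourier transform. -/
theorem spectrallyBounded_of_tendsto {u v : ℝ → ℝ} {w : ℕ → ℝ → ℝ} {m : ℕ → ℝ → ℂ} {M : ℝ → ℝ}
    (hw : ∀ n, Measurable (w n)) (hlim : ∀ x, Tendsto (fun n => w n x) atTop (𝓝 (v x)))
    (hs : ∀ n, HasSpectrum (w n) fun ξ => m n ξ * fourierL2 u ξ)
    (hm : ∀ n ξ, ‖m n ξ‖ ^ 2 ≤ M ξ) :
    SpectrallyBounded v fun ξ => ENNReal.ofReal (M ξ) * density u ξ := by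
  refine ⟨lintegral_sq_le_of_tendsto hw hlim fun n => (hs n).lintegral_sq_le (hm n), fun s => ?_⟩
  refine lintegral_sq_le_of_tendsto (w := fun n x => w n x - w n (x - s))
    (fun n => (hw n).sub ((hw n).comp (measurable_id.sub_const s)))
    (fun x => (hlim x).sub (hlim (x - s))) fun n => ?_
  refine (((hs n).increment s).lintegral_sq_le
    (M := fun ξ => min 4 (s ^ 2 * ξ ^ 2) * M ξ) fun ξ => ?_).trans_eq ?_
  · rw [norm_mul, mul_pow]
    have := norm_one_sub_exp_sq_le (s * ξ)
    rw [mul_pow] at this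
    exact mul_le_mul this (hm n ξ) (by positivity) (by positivity)
  · refine lintegral_congr fun ξ => ?_
    rw [ENNReal.ofReal_mul (by positivity), mul_assoc]

theorem spectrallyBounded_increment {u : ℝ → ℝ} (hu : Measurable u) (hL : MemLp u 2 volume)
    (a : ℝ) : SpectrallyBounded (fun x => u x - u (x - a))
      fun ξ => ENNReal.ofReal (min 4 (a ^ 2 * ξ ^ 2)) * density u ξ := by
  have h0 : HasSpectrum u fun ξ => (1 : ℂ) * fourierL2 u ξ := by
    simpa using hasSpectrum_fourierL2 hL
  refine spectrallyBounded_of_tendsto (w := fun _ x => u x - u (x - a))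
    (fun _ => hu.sub (hu.comp (measurable_id.sub_const a))) (fun x => tendsto_const_nhds)
    (fun _ => h0.increment a) fun _ ξ => ?_
  rw [mul_one, ← mul_pow]
  exact norm_one_sub_exp_sq_le (a * ξ)

theorem HasSpectrum.slope {u : ℝ → ℝ} (hL : MemLp u 2 volume) (a : ℝ) :
    HasSpectrum (fun x => slope a u x)
      fun ξ => ((a⁻¹ : ℝ) * (1 - Complex.exp (-(a * ξ : ℝ) * Complex.I))) * fourierL2 u ξ := by
  have h0 : HasSpectrum u fun ξ => (1 : ℂ) * fourierL2 u ξ := by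
    simpa using hasSpectrum_fourierL2 hL
  convert! (h0.increment a).const_mul a⁻¹ using 2
  · rw [Muskat.slope, div_eq_inv_mul]
  · ring

theorem tendsto_slope {u : ℝ → ℝ} (hu : Differentiable ℝ u) (x : ℝ) {b : ℕ → ℝ}
    (hb : Tendsto b atTop (𝓝 0)) (hb0 : ∀ n, b n ≠ 0) :
    Tendsto (fun n => slope (b n) u x) atTop (𝓝 (deriv u x)) := by
  have h := (hu x).hasDerivAt.tendsto_slope_zero
  have h2 : Tendsto (fun n => -b n) atTop (𝓝[≠] 0) := by
    refine tendsto_nhdsWithin_iff.2 ⟨by simpa using hb.neg, Eventually.of_forall fun n => ?_⟩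
    simpa using hb0 n
  refine (h.comp h2).congr fun n => ?_
  simp only [Function.comp_apply, smul_eq_mul, slope, ← sub_eq_add_neg]
  field_simp [hb0 n]
  ring

theorem norm_multiplier_slope_le (a ξ : ℝ) :
    ‖((a⁻¹ : ℝ) : ℂ) * (1 - Complex.exp (-(a * ξ : ℝ) * Complex.I))‖ ^ 2 ≤ ξ ^ 2 := by
  -- At `a = 0` the convention `0⁻¹ = 0` makes the symbol vanish.
  rcases eq_or_ne a 0 with rfl | ha
  · simpa using sq_nonneg ξ
  rw [norm_mul, mul_pow, Complex.norm_real, Real.norm_eq_abs, sq_abs]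
  have := (norm_one_sub_exp_sq_le (a * ξ)).trans (min_le_right _ _)
  calc _ ≤ a⁻¹ ^ 2 * (a * ξ) ^ 2 := by gcongr
    _ = ξ ^ 2 := by field_simp

theorem spectrallyBounded_deriv {u : ℝ → ℝ} (hu : Differentiable ℝ u) (hL : MemLp u 2 volume) :
    SpectrallyBounded (deriv u) fun ξ => ENNReal.ofReal (ξ ^ 2) * density u ξ := by
  have hb : Tendsto (fun n : ℕ => 1 / ((n : ℝ) + 1)) atTop (𝓝 0) :=
    tendsto_one_div_add_atTop_nhds_zero_nat
  refine spectrallyBounded_of_tendsto (w := fun n x => slope (1 / ((n : ℝ) + 1)) u x)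
    (fun n => ?_) (fun x => tendsto_slope hu x hb fun n => by positivity)
    (fun n => HasSpectrum.slope hL _) fun n ξ => norm_multiplier_slope_le _ ξ
  have := hu.continuous.measurable
  unfold slope
  fun_prop

/-- The second-order Taylor bound for the symbol of the slope. -/
theorem norm_multiplier_slope_sub_le {a : ℝ} (ha : a ≠ 0) (ξ : ℝ) :
    ‖((a⁻¹ : ℝ) : ℂ) * (1 - Complex.exp (-(a * ξ : ℝ) * Complex.I)) - ξ * Complex.I‖
      ≤ 2 * |a| * ξ ^ 2 := by
  set z : ℂ := -(a * ξ : ℝ) * Complex.I with hz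
  have hzn : ‖z‖ = |a * ξ| := by
    rw [hz, norm_mul, norm_neg, Complex.norm_real, Complex.norm_I, mul_one, Real.norm_eq_abs]
  have key : ‖Complex.exp z - 1 - z‖ ≤ 2 * (a * ξ) ^ 2 := by
    rw [← sq_abs (a * ξ), ← hzn]
    rcases le_total ‖z‖ 1 with h | h
    · nlinarith [Complex.norm_exp_sub_one_sub_id_le h, sq_nonneg ‖z‖]
    · have h1 := (norm_sub_le (Complex.exp z - 1) z)
      have h2 : ‖Complex.exp z - 1‖ ≤ ‖z‖ := by
        have := Real.norm_exp_I_mul_ofReal_sub_one_le (x := -(a * ξ))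
        rw [Real.norm_eq_abs, abs_neg, ← hzn, mul_comm Complex.I, Complex.ofReal_neg] at this
        exact this
      nlinarith
  have e : ((a⁻¹ : ℝ) : ℂ) * (1 - Complex.exp z) - ξ * Complex.I
      = -((a⁻¹ : ℝ) : ℂ) * (Complex.exp z - 1 - z) := by
    have : (a : ℂ) ≠ 0 := by exact_mod_cast ha
    rw [hz]; push_cast; field_simp; ring
  rw [e, norm_mul, norm_neg, Complex.norm_real, Real.norm_eq_abs, abs_inv]
  have ha' : 0 < |a| := abs_pos.2 ha
  calc _ ≤ |a|⁻¹ * (2 * (a * ξ) ^ 2) := by gcongr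
    _ = 2 * |a| * ξ ^ 2 := by
      rw [mul_pow, ← sq_abs a]; field_simp

theorem spectrallyBounded_slope_sub_deriv {u : ℝ → ℝ} (hu : Differentiable ℝ u)
    (hL : MemLp u 2 volume) {a : ℝ} (ha : a ≠ 0) :
    SpectrallyBounded (fun x => slope a u x - deriv u x)
      fun ξ => ENNReal.ofReal (16 * (ξ ^ 2 * min 4 (a ^ 2 * ξ ^ 2))) * density u ξ := by
  -- The steps `b = |a| / (n + 1)` never exceed `|a|`, so both symbols lie within `2 |a| ξ²` of
  -- `iξ`, uniformly in `n`.
  have hb : Tendsto (fun n : ℕ => |a| * (1 / ((n : ℝ) + 1))) atTop (𝓝 0) := by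
    simpa using tendsto_one_div_add_atTop_nhds_zero_nat.const_mul |a|
  have ha' : 0 < |a| := abs_pos.2 ha
  have hm := hu.continuous.measurable
  refine spectrallyBounded_of_tendsto
    (w := fun n x => slope a u x - slope (|a| * (1 / ((n : ℝ) + 1))) u x)
    (m := fun n ξ => ((a⁻¹ : ℝ) * (1 - Complex.exp (-(a * ξ : ℝ) * Complex.I)))
      - (((|a| * (1 / ((n : ℝ) + 1)))⁻¹ : ℝ)
        * (1 - Complex.exp (-(|a| * (1 / ((n : ℝ) + 1)) * ξ : ℝ) * Complex.I))))
    (fun n => ?_) (fun x => tendsto_const_nhds.sub (tendsto_slope hu x hb fun n => by positivity))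
    (fun n => ?_) fun n ξ => ?_
  · unfold slope
    fun_prop
  · convert! (HasSpectrum.slope hL a).sub (HasSpectrum.slope hL _) using 2
    rw [sub_mul]
  · set b := |a| * (1 / ((n : ℝ) + 1)) with hbdef
    have hb0 : 0 < b := by positivity
    have hba : b ≤ |a| := by
      rw [hbdef]
      refine mul_le_of_le_one_right ha'.le ?_
      rw [div_le_one (by positivity)]
      linarith [(Nat.cast_nonneg n : (0 : ℝ) ≤ n)]
    set p := ((a⁻¹ : ℝ) : ℂ) * (1 - Complex.exp (-(a * ξ : ℝ) * Complex.I))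
    set q := ((b⁻¹ : ℝ) : ℂ) * (1 - Complex.exp (-(b * ξ : ℝ) * Complex.I))
    have hp : ‖p‖ ^ 2 ≤ ξ ^ 2 := norm_multiplier_slope_le a ξ
    have hq : ‖q‖ ^ 2 ≤ ξ ^ 2 := norm_multiplier_slope_le b ξ
    have hp' : ‖p - ξ * Complex.I‖ ≤ 2 * |a| * ξ ^ 2 := norm_multiplier_slope_sub_le ha ξ
    have hq' : ‖q - ξ * Complex.I‖ ≤ 2 * |b| * ξ ^ 2 := norm_multiplier_slope_sub_le hb0.ne' ξ
    have h1 : ‖p - q‖ ≤ ‖p‖ + ‖q‖ := norm_sub_le _ _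
    have h2 : ‖p - q‖ ≤ 4 * |a| * ξ ^ 2 := by
      calc ‖p - q‖ = ‖(p - ξ * Complex.I) - (q - ξ * Complex.I)‖ := by congr 1; ring
        _ ≤ _ := norm_sub_le _ _
        _ ≤ 2 * |a| * ξ ^ 2 + 2 * |b| * ξ ^ 2 := add_le_add hp' hq'
        _ ≤ 2 * |a| * ξ ^ 2 + 2 * |a| * ξ ^ 2 := by
          rw [abs_of_pos hb0]; gcongr
        _ = _ := by ring
    rw [mul_min_of_nonneg _ _ (by positivity), mul_min_of_nonneg _ _ (by positivity)]
    refine le_min ?_ ?_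
    · nlinarith [norm_nonneg (p - q), norm_nonneg p, norm_nonneg q, sq_nonneg (‖p‖ - ‖q‖)]
    · calc ‖p - q‖ ^ 2 ≤ (4 * |a| * ξ ^ 2) ^ 2 := by gcongr
        _ = 16 * (ξ ^ 2 * (a ^ 2 * ξ ^ 2)) := by rw [mul_pow, mul_pow, sq_abs]; ring

/-! ### The Gagliardo seminorm and the Gagliardo-Nirenberg inequality. -/

/-- With `t = sξ` this is `min(4, t²) ≤ 5t² / (1 + t²)`, checked separately for `t² ≤ 4` and `t² >
4`. The majorant is integrable in `s`, with integral `5π|ξ| ≤ 16|ξ|`. -/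
theorem min_mul_inv_sq_le (s ξ : ℝ) :
    min 4 (s ^ 2 * ξ ^ 2) * (s ^ 2)⁻¹ ≤ 5 * ξ ^ 2 * (1 + (ξ * s) ^ 2)⁻¹ := by
  rcases eq_or_ne s 0 with rfl | hs
  · simp; positivity
  have hs2 : 0 < s ^ 2 := by positivity
  rw [← div_eq_mul_inv, ← div_eq_mul_inv, div_le_div_iff₀ hs2 (by positivity)]
  rcases min_cases 4 (s ^ 2 * ξ ^ 2) with ⟨h, h'⟩ | ⟨h, h'⟩ <;> rw [h] <;> nlinarith

theorem lintegral_min_mul_inv_sq_le (ξ : ℝ) :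
    ∫⁻ s : ℝ, ENNReal.ofReal (min 4 (s ^ 2 * ξ ^ 2) * (s ^ 2)⁻¹) ≤ ENNReal.ofReal (16 * |ξ|) := by
  rcases eq_or_ne ξ 0 with rfl | hξ
  · simp
  have hint : Integrable fun s : ℝ => 5 * ξ ^ 2 * (1 + (ξ * s) ^ 2)⁻¹ :=
    (integrable_inv_one_add_sq.comp_mul_left' hξ).const_mul _
  calc ∫⁻ s : ℝ, ENNReal.ofReal (min 4 (s ^ 2 * ξ ^ 2) * (s ^ 2)⁻¹)
      ≤ ∫⁻ s : ℝ, ENNReal.ofReal (5 * ξ ^ 2 * (1 + (ξ * s) ^ 2)⁻¹) :=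
        lintegral_mono fun s => ENNReal.ofReal_le_ofReal (min_mul_inv_sq_le s ξ)
    _ = ENNReal.ofReal (∫ s : ℝ, 5 * ξ ^ 2 * (1 + (ξ * s) ^ 2)⁻¹) :=
        (ofReal_integral_eq_lintegral_ofReal hint (ae_of_all _ fun s => by positivity)).symm
    _ ≤ ENNReal.ofReal (16 * |ξ|) := by
        apply ENNReal.ofReal_le_ofReal
        rw [integral_const_mul, Measure.integral_comp_mul_left (fun t : ℝ => (1 + t ^ 2)⁻¹) ξ,
          integral_univ_inv_one_add_sq, smul_eq_mul, abs_inv, ← sq_abs ξ]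
        have : 0 < |ξ| := abs_pos.2 hξ
        field_simp
        nlinarith [Real.pi_lt_d2]

/-- Source of the low-frequency damping: for `λ|ξ| ≤ 1` the integrand is at most `ξ²` on an interval
of length `2λ`; otherwise the integral over the whole line is used. -/
theorem setLIntegral_min_mul_inv_sq_le {lam : ℝ} (hlam : 0 < lam) (ξ : ℝ) :
    ∫⁻ s in Set.Icc (-lam) lam, ENNReal.ofReal (min 4 (s ^ 2 * ξ ^ 2) * (s ^ 2)⁻¹)
      ≤ ENNReal.ofReal (16 * (|ξ| * min (lam * |ξ|) 1)) := by
  rcases min_cases (lam * |ξ|) 1 with ⟨h, h'⟩ | ⟨h, h'⟩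
  · calc _ ≤ ∫⁻ _ in Set.Icc (-lam) lam, ENNReal.ofReal (ξ ^ 2) := by
          refine lintegral_mono fun s => ENNReal.ofReal_le_ofReal ?_
          rcases eq_or_ne s 0 with rfl | hs
          · simp; positivity
          · rw [← div_eq_mul_inv, div_le_iff₀ (by positivity), mul_comm (ξ ^ 2)]
            exact min_le_right _ _
      _ ≤ _ := by
          rw [setLIntegral_const, Real.volume_Icc, ← ENNReal.ofReal_mul (by positivity)]
          apply ENNReal.ofReal_le_ofReal
          rw [h, ← sq_abs ξ]
          nlinarith [mul_nonneg hlam.le (sq_nonneg |ξ|)]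
  · rw [h, mul_one]
    exact (setLIntegral_le_lintegral _ _).trans (lintegral_min_mul_inv_sq_le ξ)

/-- The local Gagliardo density `∫ |v(x) - v(x - s)|² / s² ds`. -/
def gagliardo (v : ℝ → ℝ) (x : ℝ) : ENNReal :=
  ∫⁻ s : ℝ, ENNReal.ofReal (s ^ 2)⁻¹ * ‖v x - v (x - s)‖ₑ ^ 2

theorem measurable_gagliardo_kernel {v : ℝ → ℝ} (hv : Measurable v) :
    Measurable fun p : ℝ × ℝ => ENNReal.ofReal (p.2 ^ 2)⁻¹ * ‖v p.1 - v (p.1 - p.2)‖ₑ ^ 2 := by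
  fun_prop

theorem measurable_gagliardo {v : ℝ → ℝ} (hv : Measurable v) : Measurable (gagliardo v) :=
  (measurable_gagliardo_kernel hv).lintegral_prod_right'

theorem SpectrallyBounded.lintegral_gagliardo_le {v : ℝ → ℝ} {W : ℝ → ENNReal}
    (hv : Measurable v) (hW : Measurable W) (h : SpectrallyBounded v W) :
    ∫⁻ x, gagliardo v x ≤ 16 * ∫⁻ ξ, ENNReal.ofReal |ξ| * W ξ := by
  unfold gagliardo
  rw [lintegral_lintegral_swap (measurable_gagliardo_kernel hv).aemeasurable]
  calc ∫⁻ s : ℝ, ∫⁻ x : ℝ, ENNReal.ofReal (s ^ 2)⁻¹ * ‖v x - v (x - s)‖ₑ ^ 2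
      ≤ ∫⁻ s : ℝ, ∫⁻ ξ : ℝ, ENNReal.ofReal (min 4 (s ^ 2 * ξ ^ 2) * (s ^ 2)⁻¹) * W ξ := by
        refine lintegral_mono fun s => ?_
        rw [lintegral_const_mul' _ _ ENNReal.ofReal_ne_top]
        refine (mul_le_mul_right (h.increment_le s) _).trans_eq ?_
        rw [← lintegral_const_mul' _ _ ENNReal.ofReal_ne_top]
        refine lintegral_congr fun ξ => ?_
        rw [← mul_assoc, ← ENNReal.ofReal_mul (by positivity), mul_comm (s ^ 2)⁻¹]
    _ = ∫⁻ ξ : ℝ, ∫⁻ s : ℝ, ENNReal.ofReal (min 4 (s ^ 2 * ξ ^ 2) * (s ^ 2)⁻¹) * W ξ :=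
        lintegral_lintegral_swap (by fun_prop)
    _ ≤ ∫⁻ ξ : ℝ, ENNReal.ofReal (16 * |ξ|) * W ξ := by
        refine lintegral_mono fun ξ => ?_
        rw [lintegral_mul_const _ (by fun_prop)]
        exact mul_le_mul_left (lintegral_min_mul_inv_sq_le ξ) _
    _ = _ := by
        rw [← lintegral_const_mul' _ _ (by norm_num)]
        refine lintegral_congr fun ξ => ?_
        rw [ENNReal.ofReal_mul (by norm_num), mul_assoc]
        norm_num

theorem sq_le_of_forall_mul_le {y A D : ℝ} (hy : 0 ≤ y) (hA : 0 ≤ A) (hD : 0 ≤ D)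
    (h : ∀ r : ℝ, 0 < r → r * y ≤ 2 * A + 2 * r ^ 2 * D) : y ^ 2 ≤ 16 * A * D := by
  rcases hy.eq_or_lt with rfl | hy
  · simp; positivity
  rcases hD.eq_or_lt with rfl | hD
  · have := h (2 * A / y + 1) (by positivity)
    rw [add_mul, div_mul_cancel₀ _ hy.ne'] at this
    linarith
  · have := h (y / (4 * D)) (by positivity)
    have e1 : y / (4 * D) * y = y ^ 2 / (4 * D) := by ring
    have e2 : 2 * (y / (4 * D)) ^ 2 * D = y ^ 2 / (8 * D) := by field_simp; ring
    rw [e1, e2] at this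
    have e3 : y ^ 2 / (4 * D) = 2 * (y ^ 2 / (8 * D)) := by field_simp; ring
    rw [e3] at this
    have h4 : y ^ 2 / (8 * D) ≤ 2 * A := by linarith
    rw [div_le_iff₀ (by positivity)] at h4
    linarith

/-- Average `|v(x)|² ≤ 2|v(x - s)|² + 2|v(x) - v(x - s)|²` over `0 < s ≤ r`, inserting `1 ≤ r² / s²`
in the last term. -/
theorem mul_enorm_sq_le {v : ℝ → ℝ} (hv : Measurable v) (x : ℝ) {r : ℝ} (hr : 0 < r) :
    ENNReal.ofReal r * ‖v x‖ₑ ^ 2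
      ≤ 2 * (∫⁻ y, ‖v y‖ₑ ^ 2) + 2 * ENNReal.ofReal (r ^ 2) * gagliardo v x := by
  have hpt : ∀ s ∈ Set.Ioc 0 r, ‖v x‖ₑ ^ 2 ≤ 2 * ‖v (x - s)‖ₑ ^ 2
      + 2 * ENNReal.ofReal (r ^ 2) * (ENNReal.ofReal (s ^ 2)⁻¹ * ‖v x - v (x - s)‖ₑ ^ 2) := by
    intro s hs
    simp only [Real.enorm_eq_ofReal_abs]
    rw [← ENNReal.ofReal_ofNat 2]
    simp only [← ENNReal.ofReal_pow (abs_nonneg _), sq_abs]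
    have h1 : 1 ≤ r ^ 2 * (s ^ 2)⁻¹ := by
      rw [← div_eq_mul_inv, one_le_div (by have := hs.1; positivity)]
      have := hs.1; have := hs.2
      gcongr
    have h0 := hs.1
    repeat rw [← ENNReal.ofReal_mul (by positivity)]
    rw [← ENNReal.ofReal_add (by positivity) (by positivity)]
    apply ENNReal.ofReal_le_ofReal
    have h2 := mul_le_mul_of_nonneg_right h1 (sq_nonneg (v x - v (x - s)))
    nlinarith [sq_nonneg (v x - 2 * v (x - s))]
  calc ENNReal.ofReal r * ‖v x‖ₑ ^ 2 = ∫⁻ _ in Set.Ioc 0 r, ‖v x‖ₑ ^ 2 := by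
        rw [setLIntegral_const, Real.volume_Ioc, sub_zero, mul_comm]
    _ ≤ ∫⁻ s in Set.Ioc 0 r, (2 * ‖v (x - s)‖ₑ ^ 2
      + 2 * ENNReal.ofReal (r ^ 2) * (ENNReal.ofReal (s ^ 2)⁻¹ * ‖v x - v (x - s)‖ₑ ^ 2)) :=
        setLIntegral_mono (by fun_prop) hpt
    _ ≤ ∫⁻ s, (2 * ‖v (x - s)‖ₑ ^ 2
      + 2 * ENNReal.ofReal (r ^ 2) * (ENNReal.ofReal (s ^ 2)⁻¹ * ‖v x - v (x - s)‖ₑ ^ 2)) :=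
        setLIntegral_le_lintegral _ _
    _ = _ := by
        rw [lintegral_add_left (by fun_prop), lintegral_const_mul _ (by fun_prop),
          lintegral_const_mul _ (by fun_prop),
          lintegral_sub_left_eq_self (fun y => ‖v y‖ₑ ^ 2) x]
        rfl

/-- The previous bound optimised in `r` at each point separately; integrating in `x` then gives the
`L⁴` inequality. -/
theorem enorm_pow_four_le {v : ℝ → ℝ} (hv : Measurable v) (hA : ∫⁻ y, ‖v y‖ₑ ^ 2 ≠ ⊤) {x : ℝ}
    (hD : gagliardo v x ≠ ⊤) :
    ‖v x‖ₑ ^ 4 ≤ 16 * (∫⁻ y, ‖v y‖ₑ ^ 2) * gagliardo v x := by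
  lift (∫⁻ y, ‖v y‖ₑ ^ 2) to NNReal using hA with A hA'
  lift gagliardo v x to NNReal using hD with D hD'
  have key : (v x ^ 2) ^ 2 ≤ 16 * (A : ℝ) * D := by
    refine sq_le_of_forall_mul_le (sq_nonneg _) A.2 D.2 fun r hr => ?_
    have := mul_enorm_sq_le hv x hr
    rw [← hA', ← hD', Real.enorm_eq_ofReal_abs, ← ENNReal.ofReal_pow (abs_nonneg _), sq_abs,
      ← ENNReal.ofReal_mul hr.le, ← ENNReal.ofReal_coe_nnreal, ← ENNReal.ofReal_coe_nnreal (p := D),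
      ← ENNReal.ofReal_ofNat 2, ← ENNReal.ofReal_mul (by norm_num),
      ← ENNReal.ofReal_mul (by norm_num), ← ENNReal.ofReal_mul (by positivity),
      ← ENNReal.ofReal_add (by positivity) (by positivity),
      ENNReal.ofReal_le_ofReal_iff (by positivity)] at this
    exact this
  rw [Real.enorm_eq_ofReal_abs, ← ENNReal.ofReal_pow (abs_nonneg _),
    ← ENNReal.ofReal_coe_nnreal, ← ENNReal.ofReal_coe_nnreal (p := D),
      ← ENNReal.ofReal_ofNat 16, ← ENNReal.ofReal_mul (by norm_num),
      ← ENNReal.ofReal_mul (by positivity)]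
  apply ENNReal.ofReal_le_ofReal
  rw [show |v x| ^ 4 = (|v x| ^ 2) ^ 2 by ring, sq_abs]
  exact key

/-- A Gagliardo-Nirenberg inequality: `‖v‖₄⁴ ≲ ‖v‖₂² ‖v‖²_{Ḣ^{1/2}}`. -/
theorem SpectrallyBounded.lintegral_pow_four_le {v : ℝ → ℝ} {W : ℝ → ENNReal}
    (hv : Measurable v) (hW : Measurable W) (h : SpectrallyBounded v W)
    (h0 : ∫⁻ ξ, W ξ ≠ ⊤) (h1 : ∫⁻ ξ, ENNReal.ofReal |ξ| * W ξ ≠ ⊤) :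
    ∫⁻ x, ‖v x‖ₑ ^ 4 ≤ 256 * (∫⁻ ξ, W ξ) * ∫⁻ ξ, ENNReal.ofReal |ξ| * W ξ := by
  have hg := h.lintegral_gagliardo_le hv hW
  have hA : ∫⁻ y, ‖v y‖ₑ ^ 2 ≠ ⊤ := ne_top_of_le_ne_top h0 h.sq_le
  have hfin := ae_lt_top (measurable_gagliardo hv)
    (ne_top_of_le_ne_top (ENNReal.mul_ne_top (by norm_num) h1) hg)
  calc ∫⁻ x, ‖v x‖ₑ ^ 4 ≤ ∫⁻ x, 16 * (∫⁻ y, ‖v y‖ₑ ^ 2) * gagliardo v x := by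
        refine lintegral_mono_ae ?_
        filter_upwards [hfin] with x hx
        exact enorm_pow_four_le hv hA hx.ne
    _ = 16 * (∫⁻ y, ‖v y‖ₑ ^ 2) * ∫⁻ x, gagliardo v x :=
        lintegral_const_mul _ (measurable_gagliardo hv)
    _ ≤ 16 * (∫⁻ ξ, W ξ) * (16 * ∫⁻ ξ, ENNReal.ofReal |ξ| * W ξ) := by
        exact mul_le_mul' (mul_le_mul' le_rfl h.sq_le) hg
    _ = _ := by ring

/-! ### Energies, and `L²` and `L⁴` bounds for increments and deviations. -/

/-- The homogeneous energy `∫ |ξ|^k |û(ξ)|² dξ / 2π`. -/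
def energy (k : ℕ) (u : ℝ → ℝ) : ENNReal :=
  ∫⁻ ξ, ENNReal.ofReal (|ξ| ^ k) * density u ξ

/-- The energy of order `3` damped at frequencies below `1 / lam`. -/
def energyTrunc (lam : ℝ) (u : ℝ → ℝ) : ENNReal :=
  ∫⁻ ξ, ENNReal.ofReal (|ξ| ^ 3 * min (lam * |ξ|) 1) * density u ξ

/-- The difference between the slope and the derivative. -/
def deviation (u : ℝ → ℝ) (a x : ℝ) : ℝ := slope a u x - deriv u x

/-- The density that controls `deviation u a`. -/
def deviationDensity (u : ℝ → ℝ) (a ξ : ℝ) : ENNReal :=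
  ENNReal.ofReal (16 * (ξ ^ 2 * min 4 (a ^ 2 * ξ ^ 2))) * density u ξ

/-- Interpolating between the two bounds gives up one power of `|ξ|` for one power of `|a|`; every
growth factor `|a|` below comes from here. -/
theorem min_sq_le (a ξ : ℝ) : min 4 (a ^ 2 * ξ ^ 2) ≤ 2 * |a| * |ξ| := by
  have h : a ^ 2 * ξ ^ 2 = (|a| * |ξ|) ^ 2 := by rw [mul_pow, sq_abs, sq_abs]
  rw [h]
  have h0 : 0 ≤ |a| * |ξ| := by positivity
  rcases le_total (|a| * |ξ|) 2 with h1 | h1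
  · exact (min_le_right _ _).trans (by nlinarith)
  · exact (min_le_left _ _).trans (by nlinarith)

theorem lintegral_ofReal_mul_le {p q : ℝ → ℝ} {c : ℝ} (hc : 0 ≤ c) {W : ℝ → ENNReal}
    (h : ∀ ξ, p ξ ≤ c * q ξ) :
    ∫⁻ ξ, ENNReal.ofReal (p ξ) * W ξ ≤ ENNReal.ofReal c * ∫⁻ ξ, ENNReal.ofReal (q ξ) * W ξ := by
  rw [← lintegral_const_mul' _ _ ENNReal.ofReal_ne_top]
  refine lintegral_mono fun ξ => ?_
  rw [← mul_assoc, ← ENNReal.ofReal_mul hc]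
  gcongr
  exact h ξ

theorem lintegral_abs_mul_ofReal_mul_le {p q : ℝ → ℝ} {c : ℝ} (hc : 0 ≤ c) {W : ℝ → ENNReal}
    (h : ∀ ξ, |ξ| * p ξ ≤ c * q ξ) :
    ∫⁻ ξ, ENNReal.ofReal |ξ| * (ENNReal.ofReal (p ξ) * W ξ)
      ≤ ENNReal.ofReal c * ∫⁻ ξ, ENNReal.ofReal (q ξ) * W ξ := by
  refine le_trans (le_of_eq ?_) (lintegral_ofReal_mul_le hc h)
  refine lintegral_congr fun ξ => ?_
  rw [← mul_assoc, ← ENNReal.ofReal_mul (abs_nonneg _)]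

theorem lintegral_increment_density_le (u : ℝ → ℝ) (a : ℝ) :
    ∫⁻ ξ, ENNReal.ofReal (min 4 (a ^ 2 * ξ ^ 2)) * density u ξ
      ≤ ENNReal.ofReal (2 * |a|) * energy 1 u :=
  lintegral_ofReal_mul_le (by positivity) fun ξ => by rw [pow_one]; exact min_sq_le a ξ

theorem lintegral_abs_mul_increment_density_le (u : ℝ → ℝ) (a : ℝ) :
    ∫⁻ ξ, ENNReal.ofReal |ξ| * (ENNReal.ofReal (min 4 (a ^ 2 * ξ ^ 2)) * density u ξ)
      ≤ ENNReal.ofReal 4 * energy 1 u :=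
  lintegral_abs_mul_ofReal_mul_le (by norm_num) fun ξ => by
    rw [pow_one, mul_comm]; gcongr; apply min_le_left

theorem lintegral_deviationDensity_le (u : ℝ → ℝ) (a : ℝ) :
    ∫⁻ ξ, deviationDensity u a ξ ≤ ENNReal.ofReal (32 * |a|) * energy 3 u :=
  lintegral_ofReal_mul_le (by positivity) fun ξ => by
    calc _ ≤ 16 * (ξ ^ 2 * (2 * |a| * |ξ|)) := by gcongr; exact min_sq_le a ξ
      _ = _ := by rw [← sq_abs ξ]; ring

theorem lintegral_abs_mul_deviationDensity_le (u : ℝ → ℝ) (a : ℝ) :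
    ∫⁻ ξ, ENNReal.ofReal |ξ| * deviationDensity u a ξ ≤ ENNReal.ofReal 64 * energy 3 u :=
  lintegral_abs_mul_ofReal_mul_le (by norm_num) fun ξ => by
    calc |ξ| * (16 * (ξ ^ 2 * min 4 (a ^ 2 * ξ ^ 2))) ≤ |ξ| * (16 * (ξ ^ 2 * 4)) := by
          gcongr; exact min_le_left _ _
      _ = _ := by rw [← sq_abs ξ]; ring

@[fun_prop]
theorem measurable_deviationDensity (u : ℝ → ℝ) (a : ℝ) : Measurable (deviationDensity u a) := by
  unfold deviationDensity
  fun_prop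

theorem lintegral_increment_pow_four_le {u : ℝ → ℝ} (hu : Measurable u) (hL : MemLp u 2 volume)
    (hE : energy 1 u ≠ ⊤) (a : ℝ) :
    ∫⁻ x, ‖u x - u (x - a)‖ₑ ^ 4 ≤ ENNReal.ofReal (2048 * |a|) * energy 1 u ^ 2 := by
  have h1 := lintegral_increment_density_le u a
  have h2 := lintegral_abs_mul_increment_density_le u a
  refine ((spectrallyBounded_increment hu hL a).lintegral_pow_four_le
    (hu.sub (hu.comp (measurable_id.sub_const a))) (by fun_prop)
    (ne_top_of_le_ne_top (ENNReal.mul_ne_top ENNReal.ofReal_ne_top hE) h1)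
    (ne_top_of_le_ne_top (ENNReal.mul_ne_top ENNReal.ofReal_ne_top hE) h2)).trans ?_
  refine (mul_le_mul' (mul_le_mul' le_rfl h1) h2).trans_eq ?_
  rw [show 2048 * |a| = 256 * (2 * |a|) * 4 by ring, 
    ENNReal.ofReal_mul (p := 256 * (2 * |a|)) (by positivity),
    ENNReal.ofReal_mul (p := 256) (by positivity), ENNReal.ofReal_ofNat 256]
  ring

theorem lintegral_deviation_sq_le {u : ℝ → ℝ} (hu : Differentiable ℝ u) (hL : MemLp u 2 volume)
    {a : ℝ} (ha : a ≠ 0) :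
    ∫⁻ x, ‖deviation u a x‖ₑ ^ 2 ≤ ∫⁻ ξ, deviationDensity u a ξ :=
  (spectrallyBounded_slope_sub_deriv hu hL ha).sq_le

@[fun_prop]
theorem measurable_slope_uncurry {u : ℝ → ℝ} (hu : Measurable u) :
    Measurable fun p : ℝ × ℝ => slope p.1 u p.2 := by
  unfold slope
  fun_prop

theorem measurable_deviation {u : ℝ → ℝ} (hu : Measurable u) :
    Measurable fun p : ℝ × ℝ => deviation u p.1 p.2 := by
  have := measurable_deriv u
  unfold deviation
  have := measurable_slope_uncurry hu
  fun_prop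

/-- The `L²` factor is left as `∫ deviationDensity`: the near part integrates it against `da / a²`,
and its bound by a multiple of `|a|` would make that integral diverge at `0`. The far part uses the
version with `|a|`. -/
theorem lintegral_deviation_pow_four_le_aux {u : ℝ → ℝ} (hu : Differentiable ℝ u)
    (hL : MemLp u 2 volume) (hE : energy 3 u ≠ ⊤) {a : ℝ} (ha : a ≠ 0) :
    ∫⁻ x, ‖deviation u a x‖ₑ ^ 4
      ≤ ENNReal.ofReal 16384 * energy 3 u * ∫⁻ ξ, deviationDensity u a ξ := by
  have h1 := lintegral_deviationDensity_le u a
  have h2 := lintegral_abs_mul_deviationDensity_le u a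
  refine ((spectrallyBounded_slope_sub_deriv hu hL ha).lintegral_pow_four_le
    ((measurable_deviation hu.continuous.measurable).comp measurable_prodMk_left)
    (measurable_deviationDensity u a)
    (ne_top_of_le_ne_top (ENNReal.mul_ne_top ENNReal.ofReal_ne_top hE) h1)
    (ne_top_of_le_ne_top (ENNReal.mul_ne_top ENNReal.ofReal_ne_top hE) h2)).trans ?_
  refine (mul_le_mul' le_rfl h2).trans_eq ?_
  rw [show (16384 : ℝ) = 256 * 64 by norm_num, ENNReal.ofReal_mul (by positivity),
    ENNReal.ofReal_ofNat 256]
  unfold deviationDensity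
  ring

theorem lintegral_deviation_pow_four_le {u : ℝ → ℝ} (hu : Differentiable ℝ u)
    (hL : MemLp u 2 volume) (hE : energy 3 u ≠ ⊤) {a : ℝ} (ha : a ≠ 0) :
    ∫⁻ x, ‖deviation u a x‖ₑ ^ 4 ≤ ENNReal.ofReal (2 ^ 19 * |a|) * energy 3 u ^ 2 := by
  refine (lintegral_deviation_pow_four_le_aux hu hL hE ha).trans ?_
  refine (mul_le_mul' le_rfl (lintegral_deviationDensity_le u a)).trans_eq ?_
  rw [show (2 : ℝ) ^ 19 * |a| = 16384 * (32 * |a|) by ring,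
    ENNReal.ofReal_mul (p := 16384) (by positivity)]
  ring

theorem setLIntegral_deviationDensity_le (u : ℝ → ℝ) {lam : ℝ} (hlam : 0 < lam) :
    ∫⁻ a in Set.Icc (-lam) lam, ENNReal.ofReal (a ^ 2)⁻¹ * ∫⁻ ξ, deviationDensity u a ξ
      ≤ ENNReal.ofReal 256 * energyTrunc lam u := by
  calc ∫⁻ a in Set.Icc (-lam) lam, ENNReal.ofReal (a ^ 2)⁻¹ * ∫⁻ ξ, deviationDensity u a ξ
      = ∫⁻ a in Set.Icc (-lam) lam, ∫⁻ ξ, ENNReal.ofReal (min 4 (a ^ 2 * ξ ^ 2) * (a ^ 2)⁻¹)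
          * (ENNReal.ofReal (16 * ξ ^ 2) * density u ξ) := by
        refine lintegral_congr fun a => ?_
        rw [← lintegral_const_mul' _ _ ENNReal.ofReal_ne_top]
        refine lintegral_congr fun ξ => ?_
        rw [deviationDensity, ← mul_assoc, ← mul_assoc (ENNReal.ofReal _), ← ENNReal.ofReal_mul (by positivity),
          ← ENNReal.ofReal_mul (by positivity)]
        congr 2
        ring
    _ = ∫⁻ ξ, ∫⁻ a in Set.Icc (-lam) lam, ENNReal.ofReal (min 4 (a ^ 2 * ξ ^ 2) * (a ^ 2)⁻¹)
          * (ENNReal.ofReal (16 * ξ ^ 2) * density u ξ) :=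
        lintegral_lintegral_swap (by fun_prop)
    _ ≤ ∫⁻ ξ, ENNReal.ofReal (16 * (|ξ| * min (lam * |ξ|) 1))
          * (ENNReal.ofReal (16 * ξ ^ 2) * density u ξ) := by
        refine lintegral_mono fun ξ => ?_
        rw [lintegral_mul_const _ (by fun_prop)]
        exact mul_le_mul_left (setLIntegral_min_mul_inv_sq_le hlam ξ) _
    _ = ENNReal.ofReal 256 * energyTrunc lam u := by
        rw [energyTrunc, ← lintegral_const_mul' _ _ ENNReal.ofReal_ne_top]
        refine lintegral_congr fun ξ => ?_
        rw [← mul_assoc, ← mul_assoc (ENNReal.ofReal 256), ← ENNReal.ofReal_mul (by positivity),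
          ← ENNReal.ofReal_mul (by positivity)]
        congr 2
        rw [← sq_abs ξ]
        ring

theorem setLIntegral_deviation_sq_le {u : ℝ → ℝ} (hu : Differentiable ℝ u)
    (hL : MemLp u 2 volume) {lam : ℝ} (hlam : 0 < lam) :
    ∫⁻ a in Set.Icc (-lam) lam, ENNReal.ofReal (a ^ 2)⁻¹ * ∫⁻ x, ‖deviation u a x‖ₑ ^ 2
      ≤ ENNReal.ofReal 256 * energyTrunc lam u := by
  refine le_trans (lintegral_mono fun a => ?_) (setLIntegral_deviationDensity_le u hlam)
  -- The value `a = 0`, where the slope is a default value, has weight `(0 ^ 2)⁻¹ = 0`.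
  rcases eq_or_ne a 0 with rfl | ha
  · simp
  · exact mul_le_mul' le_rfl (lintegral_deviation_sq_le hu hL ha)

/-- The sign `σ = ±1` covers the deviation seen from `x - a`, which has step `-a`; the density is
even in `a`. -/
theorem setLIntegral_deviation_pow_four_le {u : ℝ → ℝ} (hu : Differentiable ℝ u)
    (hL : MemLp u 2 volume) (hE : energy 3 u ≠ ⊤) {lam : ℝ} (hlam : 0 < lam) {σ : ℝ}
    (hσ : σ ^ 2 = 1) :
    ∫⁻ a in Set.Icc (-lam) lam, ENNReal.ofReal (a ^ 2)⁻¹ * ∫⁻ x, ‖deviation u (σ * a) x‖ₑ ^ 4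
      ≤ ENNReal.ofReal (2 ^ 22) * energy 3 u * energyTrunc lam u := by
  calc _ ≤ ∫⁻ a in Set.Icc (-lam) lam, ENNReal.ofReal 16384 * energy 3 u *
        (ENNReal.ofReal (a ^ 2)⁻¹ * ∫⁻ ξ, deviationDensity u a ξ) := by
        refine lintegral_mono fun a => ?_
        rcases eq_or_ne a 0 with rfl | ha
        · simp
        · have hσ0 : σ ≠ 0 := by rintro rfl; norm_num at hσ
          have e : deviationDensity u (σ * a) = deviationDensity u a := by
            funext ξ
            rw [deviationDensity, mul_pow, hσ, one_mul, deviationDensity]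
          refine (mul_le_mul' le_rfl (lintegral_deviation_pow_four_le_aux hu hL hE
            (mul_ne_zero hσ0 ha))).trans_eq ?_
          rw [e, mul_left_comm]
    _ ≤ ENNReal.ofReal 16384 * energy 3 u * (ENNReal.ofReal 256 * energyTrunc lam u) := by
        rw [lintegral_const_mul' _ _ (ENNReal.mul_ne_top ENNReal.ofReal_ne_top hE)]
        exact mul_le_mul' le_rfl (setLIntegral_deviationDensity_le u hlam)
    _ = _ := by
        rw [show (2 : ℝ) ^ 22 = 16384 * 256 by norm_num, ENNReal.ofReal_mul (by positivity)]
        ring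

/-! ### The saturation function and the bracket weights. -/

/-- The saturation `a² / (1 + a²)`. -/
def saturation (a : ℝ) : ℝ := a ^ 2 / (1 + a ^ 2)

theorem saturation_nonneg (a : ℝ) : 0 ≤ saturation a := by unfold saturation; positivity

theorem saturation_le_one (a : ℝ) : saturation a ≤ 1 := by
  unfold saturation
  rw [div_le_one (by positivity)]
  linarith

theorem saturation_sub (a b : ℝ) :
    saturation a - saturation b = (a - b) * (a + b) / ((1 + a ^ 2) * (1 + b ^ 2)) := by
  unfold saturation
  rw [div_sub_div _ _ (by positivity) (by positivity)]
  congr 1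
  ring

theorem abs_saturation_sub_le (a b : ℝ) : |saturation a - saturation b| ≤ |a - b| := by
  rw [saturation_sub, abs_div, abs_mul, abs_of_pos (by positivity : 0 < (1 + a ^ 2) * (1 + b ^ 2)),
    div_le_iff₀ (by positivity)]
  refine mul_le_mul_of_nonneg_left ?_ (abs_nonneg _)
  rw [abs_le]
  constructor <;> nlinarith [sq_nonneg (a + 1), sq_nonneg (a - 1), sq_nonneg (b + 1),
    sq_nonneg (b - 1), mul_nonneg (sq_nonneg a) (sq_nonneg b)]

theorem abs_saturation_sub_le_one (a b : ℝ) : |saturation a - saturation b| ≤ 1 := by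
  rw [abs_le]
  constructor <;>
  linarith [saturation_nonneg a, saturation_nonneg b, saturation_le_one a, saturation_le_one b]

theorem hasDerivAt_saturation (a : ℝ) :
    HasDerivAt saturation (2 * a / (1 + a ^ 2) ^ 2) a := by
  have h := ((hasDerivAt_id a).pow 2).div (((hasDerivAt_id a).pow 2).const_add 1)
    (by simp; positivity)
  convert! h using 1
  simp
  ring

theorem abs_deriv_saturation_le (a : ℝ) : |2 * a / (1 + a ^ 2) ^ 2| ≤ 1 := by
  rw [abs_div, abs_of_pos (by positivity : 0 < (1 + a ^ 2) ^ 2), div_le_one (by positivity), abs_le]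
  constructor <;> nlinarith [sq_nonneg (a + 1), sq_nonneg (a - 1), sq_nonneg (a ^ 2)]

@[fun_prop]
theorem measurable_saturation : Measurable saturation := by
  unfold saturation
  fun_prop

theorem bracket_pos (a : ℝ) : 0 < bracket a := Real.sqrt_pos.2 (by positivity)

theorem bracket_sq (a : ℝ) : bracket a ^ 2 = 1 + a ^ 2 := Real.sq_sqrt (by positivity)

theorem one_le_bracket (a : ℝ) : 1 ≤ bracket a := by
  unfold bracket
  rw [Real.one_le_sqrt]
  nlinarith [sq_nonneg a]

theorem abs_le_bracket (a : ℝ) : |a| ≤ bracket a := by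
  rw [← Real.sqrt_sq_eq_abs]
  exact Real.sqrt_le_sqrt (by linarith)

theorem bracket_le_add (a c : ℝ) : bracket c ≤ bracket a + |c - a| := by
  have h0 := bracket_pos a
  refine Real.sqrt_le_iff.2 ⟨by positivity, ?_⟩
  have h1 : (c - a) * a ≤ |c - a| * bracket a := by
    refine (le_abs_self _).trans ?_
    rw [abs_mul]
    gcongr
    exact abs_le_bracket a
  nlinarith [bracket_sq a, sq_abs (c - a)]

/-- The denominator `⟨a⟩²⟨b⟩²` of the difference is spent entirely: `|a + b| ≤ 2⟨a⟩⟨b⟩` takes one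
factor of each, the weight `⟨b⟩` takes another, and `⟨c⟩ ≤ ⟨a⟩(1 + |c - a|)` takes the last `⟨a⟩`.
It is applied with `a` the slope, `b = f_x(x)` and `c = f_x(x - α)`. -/
theorem bracket_mul_abs_saturation_sub_le (a b c : ℝ) :
    bracket b * bracket c * |saturation a - saturation b| ≤ 2 * |a - b| * (1 + |c - a|) := by
  have hA := bracket_pos a
  have hB := bracket_pos b
  have hA1 := one_le_bracket a
  have hB1 := one_le_bracket b
  rw [saturation_sub, abs_div, abs_mul, abs_of_pos (by positivity : 0 < (1 + a ^ 2) * (1 + b ^ 2)),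
    ← bracket_sq, ← bracket_sq, ← mul_div_assoc, div_le_iff₀ (by positivity)]
  have h1 : |a + b| ≤ bracket a + bracket b :=
    (abs_add_le a b).trans (add_le_add (abs_le_bracket a) (abs_le_bracket b))
  have h1' : |a + b| ≤ 2 * (bracket a * bracket b) := by nlinarith
  have h2 : bracket c ≤ bracket a * (1 + |c - a|) := by
    nlinarith [bracket_le_add a c, abs_nonneg (c - a)]
  have h3 : 0 ≤ |a - b| := abs_nonneg _
  have h4 : 0 ≤ |c - a| := abs_nonneg _
  calc bracket b * bracket c * (|a - b| * |a + b|)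
      ≤ bracket b * (bracket a * (1 + |c - a|)) * (|a - b| * (2 * (bracket a * bracket b))) := by
        gcongr
    _ = _ := by ring

/-! ### Convergence of the integrals and their reduction to a single kernel. -/

theorem exists_abs_sub_le_mul {u : ℝ → ℝ} (hu : ContDiff ℝ 1 u) (x R : ℝ) :
    ∃ K : ℝ, 0 ≤ K ∧ ∀ y, |y - x| ≤ R → |u y - u x| ≤ K * |y - x| := by
  obtain ⟨K, hK⟩ := (isCompact_Icc (a := x - R) (b := x + R)).exists_bound_of_continuousOn
    (hu.continuous_deriv le_rfl).continuousOn
  refine ⟨max K 0, le_max_right _ _, fun y hy => ?_⟩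
  have hR : 0 ≤ R := (abs_nonneg _).trans hy
  rw [abs_le] at hy
  exact (convex_Icc (x - R) (x + R)).norm_image_sub_le_of_norm_deriv_le
    (fun z _ => (hu.differentiable one_ne_zero) z) (fun z hz => (hK z hz).trans (le_max_left _ _))
    ⟨by linarith, by linarith⟩ ⟨by linarith, by linarith⟩

/-- Mean value inequality for `y ↦ u(y) - u'(x) y`, whose derivative is at most `K |a|` on the ball
of radius `|a|` about `x`. -/
theorem exists_abs_deviation_le {u : ℝ → ℝ} (hu : ContDiff ℝ 2 u) (x R : ℝ) :
    ∃ K : ℝ, 0 ≤ K ∧ ∀ a, a ≠ 0 → |a| ≤ R → |deviation u a x| ≤ K * |a| := by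
  have hd : Differentiable ℝ u := hu.differentiable two_ne_zero
  obtain ⟨K, hK0, hK⟩ := exists_abs_sub_le_mul
    ((contDiff_succ_iff_deriv (n := 1)).1 hu).2.2 x R
  refine ⟨K, hK0, fun a ha haR => ?_⟩
  have ha' : 0 < |a| := abs_pos.2 ha
  have hdv : ∀ y, HasDerivAt (fun y => u y - deriv u x * y) (deriv u y - deriv u x) y := fun y => by
    simpa using (hd y).hasDerivAt.fun_sub ((hasDerivAt_id y).const_mul (deriv u x))
  have key := (convex_Icc (x - |a|) (x + |a|)).norm_image_sub_le_of_norm_hasDerivWithin_le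
    (f := fun y => u y - deriv u x * y) (C := K * |a|) (x := x - a) (y := x)
    (fun y _ => (hdv y).hasDerivWithinAt) (fun y hy => by
      have hy' : |y - x| ≤ |a| := abs_le.2 ⟨by linarith [hy.1], by linarith [hy.2]⟩
      exact (hK y (hy'.trans haR)).trans (by gcongr))
    ⟨by linarith [le_abs_self a], by linarith [neg_abs_le a]⟩ ⟨by linarith, by linarith⟩
  have e : deviation u a x = (u x - deriv u x * x - (u (x - a) - deriv u x * (x - a))) / a := by
    unfold deviation slope
    field_simp
    ring
  rw [e, abs_div, div_le_iff₀ ha']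
  simpa using key

/-- For `|a| ≤ 1` the factor `φ` cancels the singularity `1 / a`; for `|a| ≥ 1` the product of `v(x
- a)` and `1 / a` is integrable because both are square integrable there. -/
theorem integrable_div_mul {v φ : ℝ → ℝ} (hv : Continuous v) (hL : MemLp v 2 volume)
    (hφ : Measurable φ) {K : ℝ} (hK : ∀ a, a ≠ 0 → |a| ≤ 1 → |φ a| ≤ K * |a|)
    (h1 : ∀ a, |φ a| ≤ 1) (x : ℝ) : Integrable fun a => v (x - a) / a * φ a := by
  obtain ⟨G, hG⟩ := (isCompact_Icc (a := x - 1) (b := x + 1)).exists_bound_of_continuousOn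
    hv.continuousOn
  have hK0 : 0 ≤ K := by simpa using (abs_nonneg _).trans (hK 1 one_ne_zero (by simp))
  have hG0 : 0 ≤ G := (norm_nonneg _).trans (hG x ⟨by linarith, by linarith⟩)
  have hsq : Integrable fun a => v (x - a) ^ 2 :=
    hL.integrable_sq.comp_sub_left x
  have hinv : Integrable fun a : ℝ => (1 + a ^ 2)⁻¹ := integrable_inv_one_add_sq
  refine ((hinv.const_mul (2 * (G * K) + 2)).add hsq).mono'
    (by have := hv.measurable; fun_prop) (ae_of_all _ fun a => ?_)
  simp only [Pi.add_apply]
  rcases eq_or_ne a 0 with rfl | ha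
  · simp; positivity
  have ha' : 0 < |a| := abs_pos.2 ha
  rw [Real.norm_eq_abs, abs_mul, abs_div]
  rcases le_total |a| 1 with h | h
  · have h2 : |v (x - a)| ≤ G := hG _ ⟨by linarith [le_abs_self a], by linarith [neg_abs_le a]⟩
    have h3 : (1 : ℝ) ≤ 2 * (1 + a ^ 2)⁻¹ := by
      rw [← div_eq_mul_inv, one_le_div (by positivity)]
      nlinarith [sq_abs a]
    calc |v (x - a)| / |a| * |φ a| ≤ G / |a| * (K * |a|) := by
          gcongr
          exact hK a ha h
      _ = G * K * 1 := by field_simp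
      _ ≤ G * K * (2 * (1 + a ^ 2)⁻¹) := by gcongr
      _ ≤ _ := by nlinarith [sq_nonneg (v (x - a)), inv_nonneg.2 (by positivity : 0 ≤ 1 + a ^ 2)]
  · have h3 : |a|⁻¹ ^ 2 ≤ 2 * (1 + a ^ 2)⁻¹ := by
      rw [← div_eq_mul_inv, inv_pow, sq_abs, inv_eq_one_div, div_le_div_iff₀ (by positivity)
        (by positivity)]
      nlinarith [sq_abs a]
    calc |v (x - a)| / |a| * |φ a| ≤ |v (x - a)| / |a| * 1 := by gcongr; exact h1 a
      _ = |v (x - a)| * |a|⁻¹ := by rw [mul_one, div_eq_mul_inv]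
      _ ≤ |v (x - a)| ^ 2 + |a|⁻¹ ^ 2 := by
          nlinarith [sq_nonneg (|v (x - a)| - |a|⁻¹), sq_nonneg (|v (x - a)|), sq_nonneg (|a|⁻¹)]
      _ ≤ _ := by
          rw [sq_abs]
          have : 0 ≤ 2 * (G * K) * (1 + a ^ 2)⁻¹ := by positivity
          nlinarith

theorem abs_saturation_slope_sub_le {f : ℝ → ℝ} (x a : ℝ) :
    |saturation (slope a f x) - saturation (deriv f x)| ≤ |deviation f a x| :=
  abs_saturation_sub_le _ _

theorem evenPart_eq (f : ℝ → ℝ) (a x : ℝ) : evenPart f a x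
    = 1 / 2 * saturation (slope a f x) + 1 / 2 * saturation (slope (-a) f x) := rfl

theorem oddPart_eq (f : ℝ → ℝ) (a x : ℝ) : oddPart f a x
    = 1 / 2 * saturation (slope a f x) - 1 / 2 * saturation (slope (-a) f x) := rfl

/-- The even part in `α` minus its value at `α = 0`. -/
def evenDeviation (f : ℝ → ℝ) (x a : ℝ) : ℝ := evenPart f a x - saturation (deriv f x)

theorem evenDeviation_neg (f : ℝ → ℝ) (x a : ℝ) :
    evenDeviation f x (-a) = evenDeviation f x a := by
  simp only [evenDeviation, evenPart_eq, neg_neg]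
  ring

theorem abs_evenDeviation_le (f : ℝ → ℝ) (x a : ℝ) :
    |evenDeviation f x a| ≤ 1 / 2 * |saturation (slope a f x) - saturation (deriv f x)|
      + 1 / 2 * |saturation (slope (-a) f x) - saturation (deriv f x)| := by
  have e : evenDeviation f x a = 1 / 2 * (saturation (slope a f x) - saturation (deriv f x))
      + 1 / 2 * (saturation (slope (-a) f x) - saturation (deriv f x)) := by
    rw [evenDeviation, evenPart_eq]
    ring
  rw [e]
  refine (abs_add_le _ _).trans ?_
  simp [abs_mul]

theorem abs_oddPart_le (f : ℝ → ℝ) (x a : ℝ) :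
    |oddPart f a x| ≤ 1 / 2 * |saturation (slope a f x) - saturation (deriv f x)|
      + 1 / 2 * |saturation (slope (-a) f x) - saturation (deriv f x)| := by
  have e : oddPart f a x = 1 / 2 * (saturation (slope a f x) - saturation (deriv f x))
      - 1 / 2 * (saturation (slope (-a) f x) - saturation (deriv f x)) := by
    rw [oddPart_eq]
    ring
  rw [e]
  refine (abs_sub _ _).trans ?_
  simp [abs_mul]

theorem measurable_slope_left {f : ℝ → ℝ} (hf : Measurable f) (x : ℝ) :
    Measurable fun a => slope a f x := (measurable_slope_uncurry hf).comp measurable_prodMk_right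

theorem measurable_oddPart {f : ℝ → ℝ} (hf : Measurable f) (x : ℝ) :
    Measurable fun a => oddPart f a x := by
  have h := measurable_slope_left hf x
  have h' := h.comp measurable_neg
  simp only [oddPart_eq]
  exact ((measurable_saturation.comp h).const_mul _).sub
    ((measurable_saturation.comp h').const_mul _)

theorem measurable_evenDeviation {f : ℝ → ℝ} (hf : Measurable f) (x : ℝ) :
    Measurable (evenDeviation f x) := by
  have h := measurable_slope_left hf x
  have h' := h.comp measurable_neg
  unfold evenDeviation
  simp only [evenPart_eq]
  exact (((measurable_saturation.comp h).const_mul _).add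
    ((measurable_saturation.comp h').const_mul _)).sub_const _

/-- The integrand of the single absolutely convergent integral that represents `π R(f)g(x)`. -/
def kernel (f g : ℝ → ℝ) (x a : ℝ) : ℝ :=
  deriv g (x - a) / a * (saturation (slope a f x) - saturation (deriv f x))

theorem half_add_half_le {p q c : ℝ} (hp : p ≤ c) (hq : q ≤ c) : 1 / 2 * p + 1 / 2 * q ≤ c := by
  linarith

theorem integrable_kernel {f g : ℝ → ℝ} (hf : ContDiff ℝ 2 f) (hg : ContDiff ℝ 2 g)
    (hL : MemLp (deriv g) 2 volume) (x : ℝ) : Integrable (kernel f g x) := by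
  obtain ⟨K, _, hK⟩ := exists_abs_deviation_le hf x 1
  exact integrable_div_mul (hg.continuous_deriv (by norm_num)) hL (K := K)
    (φ := fun a => saturation (slope a f x) - saturation (deriv f x))
    ((measurable_saturation.comp (measurable_slope_left hf.continuous.measurable x)).sub_const _)
    (fun a ha h => (abs_saturation_slope_sub_le x a).trans (hK a ha h))
    (fun a => abs_saturation_sub_le_one _ _) x

theorem integrable_integrandO {f g : ℝ → ℝ} (hf : ContDiff ℝ 2 f) (hg : ContDiff ℝ 2 g)
    (hL : MemLp (deriv g) 2 volume) (x : ℝ) : Integrable (integrandO f g x) := by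
  obtain ⟨K, _, hK⟩ := exists_abs_deviation_le hf x 1
  refine integrable_div_mul (hg.continuous_deriv (by norm_num)) hL (K := K)
    (φ := fun a => oddPart f a x) (measurable_oddPart hf.continuous.measurable x)
    (fun a ha h => (abs_oddPart_le f x a).trans (half_add_half_le ?_ ?_))
    (fun a => (abs_oddPart_le f x a).trans
      (half_add_half_le (abs_saturation_sub_le_one _ _) (abs_saturation_sub_le_one _ _))) x
  · exact (abs_saturation_slope_sub_le x a).trans (hK a ha h)
  · simpa using (abs_saturation_slope_sub_le x (-a)).trans
      (hK (-a) (neg_ne_zero.2 ha) (by rwa [abs_neg]))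

theorem abs_evenDeviation_le_one (f : ℝ → ℝ) (x a : ℝ) : |evenDeviation f x a| ≤ 1 :=
  (abs_evenDeviation_le f x a).trans
    (half_add_half_le (abs_saturation_sub_le_one _ _) (abs_saturation_sub_le_one _ _))

theorem exists_abs_evenDeviation_le {f : ℝ → ℝ} (hf : ContDiff ℝ 2 f) (x : ℝ) :
    ∃ K : ℝ, 0 ≤ K ∧ ∀ a, a ≠ 0 → |a| ≤ 1 → |evenDeviation f x a| ≤ K * |a| := by
  obtain ⟨K, hK0, hK⟩ := exists_abs_deviation_le hf x 1
  refine ⟨K, hK0, fun a ha h => (abs_evenDeviation_le f x a).trans (half_add_half_le ?_ ?_)⟩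
  · exact (abs_saturation_slope_sub_le x a).trans (hK a ha h)
  · simpa using (abs_saturation_slope_sub_le x (-a)).trans
      (hK (-a) (neg_ne_zero.2 ha) (by rwa [abs_neg]))

theorem integrable_div_mul_evenDeviation {f g : ℝ → ℝ} (hf : ContDiff ℝ 2 f)
    (hg : ContDiff ℝ 2 g) (hL : MemLp (deriv g) 2 volume) (x : ℝ) :
    Integrable fun a => deriv g (x - a) / a * evenDeviation f x a := by
  obtain ⟨K, _, hK⟩ := exists_abs_evenDeviation_le hf x
  exact integrable_div_mul (hg.continuous_deriv (by norm_num)) hL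
    (measurable_evenDeviation hf.continuous.measurable x) hK (abs_evenDeviation_le_one f x) x

theorem intervalIntegrable_evenDeviation_div {f : ℝ → ℝ} (hf : ContDiff ℝ 2 f) (x p q : ℝ) :
    IntervalIntegrable (fun a => evenDeviation f x a / a) volume p q := by
  obtain ⟨K, hK0, hK⟩ := exists_abs_evenDeviation_le hf x
  have hm := measurable_evenDeviation hf.continuous.measurable x
  refine (intervalIntegrable_const (c := K + 1)).mono_fun
    (hm.div measurable_id).aestronglyMeasurable (ae_of_all _ fun a => ?_)
  simp only [Real.norm_eq_abs]
  rw [abs_of_nonneg (by positivity : 0 ≤ K + 1)]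
  rcases eq_or_ne a 0 with rfl | ha
  · simp; positivity
  have ha' : 0 < |a| := abs_pos.2 ha
  rw [abs_div, div_le_iff₀ ha']
  rcases le_total |a| 1 with h | h
  · nlinarith [hK a ha h]
  · nlinarith [abs_evenDeviation_le_one f x a, mul_nonneg hK0 ha'.le]

theorem deriv_slope {g : ℝ → ℝ} (hg : Differentiable ℝ g) (a x : ℝ) :
    deriv (slope a g) x = (deriv g x - deriv g (x - a)) / a := by
  have h : HasDerivAt (slope a g) ((deriv g x - deriv g (x - a)) / a) x := by
    have h1 : HasDerivAt (fun y => g (y - a)) (deriv g (x - a)) x :=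
      (hg (x - a)).hasDerivAt.comp_sub_const x a
    exact ((hg x).hasDerivAt.fun_sub h1).div_const a
  exact h.deriv

theorem integrandE_eq {f g : ℝ → ℝ} (hg : Differentiable ℝ g) (x : ℝ) :
    integrandE f g x = fun a => deriv g x * (evenDeviation f x a / a)
      - deriv g (x - a) / a * evenDeviation f x a := by
  funext a
  rw [integrandE, deriv_slope hg]
  change _ * evenDeviation f x a = _
  ring

theorem integral_evenDeviation_div (f : ℝ → ℝ) (x N : ℝ) :
    ∫ a in (-N)..N, evenDeviation f x a / a = 0 := by
  have h := intervalIntegral.integral_comp_neg (a := -N) (b := N)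
    (fun a => evenDeviation f x a / a)
  simp only [evenDeviation_neg, neg_neg, div_neg, intervalIntegral.integral_neg] at h
  linarith

/-- The slowly decaying term `g_x(x) / a` multiplies an even function, so it vanishes on every
symmetric interval; the rest converges absolutely. -/
theorem tendsto_integral_integrandE {f g : ℝ → ℝ} (hf : ContDiff ℝ 2 f)
    (hg : ContDiff ℝ 2 g) (hL : MemLp (deriv g) 2 volume) (x : ℝ) :
    Tendsto (fun N : ℝ => ∫ a in (-N)..N, integrandE f g x a) atTop
      (𝓝 (-∫ a, deriv g (x - a) / a * evenDeviation f x a)) := by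
  have hint := integrable_div_mul_evenDeviation hf hg hL x
  refine (intervalIntegral_tendsto_integral hint tendsto_neg_atTop_atBot tendsto_id).neg.congr
    fun N => ?_
  rw [integrandE_eq (hg.differentiable two_ne_zero), intervalIntegral.integral_sub
    ((intervalIntegrable_evenDeviation_div hf x _ _).const_mul _) hint.intervalIntegrable,
    intervalIntegral.integral_const_mul, integral_evenDeviation_div]
  simp

theorem remainderConverges {f g : ℝ → ℝ} (hf : ContDiff ℝ 2 f)
    (hg : ContDiff ℝ 2 g) (hL : MemLp (deriv g) 2 volume) (x : ℝ) :
    RemainderConverges f g x := by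
  refine ⟨fun N => ?_, ⟨_, tendsto_integral_integrandE hf hg hL x⟩,
    integrable_integrandO hf hg hL x⟩
  rw [integrandE_eq (hg.differentiable two_ne_zero)]
  exact ((intervalIntegrable_evenDeviation_div hf x _ _).const_mul _).sub
    (integrable_div_mul_evenDeviation hf hg hL x).intervalIntegrable

/-- The even and odd parts add up to the full saturation of the slope. -/
theorem remainder_eq {f g : ℝ → ℝ} (hf : ContDiff ℝ 2 f)
    (hg : ContDiff ℝ 2 g) (hL : MemLp (deriv g) 2 volume) (x : ℝ) :
    remainder f g x = 1 / Real.pi * ∫ a, kernel f g x a := by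
  have e : ∫ a, kernel f g x a = (∫ a, deriv g (x - a) / a * evenDeviation f x a)
      + ∫ a, integrandO f g x a := by
    rw [← integral_add (integrable_div_mul_evenDeviation hf hg hL x)
      (integrable_integrandO hf hg hL x)]
    refine integral_congr_ae (ae_of_all _ fun a => ?_)
    simp only [kernel, integrandO, evenDeviation, evenPart_eq, oddPart_eq]
    ring
  rw [remainder, (tendsto_integral_integrandE hf hg hL x).limUnder_eq, e]
  ring

theorem measurable_kernel {f g : ℝ → ℝ} (hf : Measurable f) :
    Measurable fun p : ℝ × ℝ => kernel f g p.1 p.2 := by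
  have h1 := measurable_deriv g
  have h2 := measurable_deriv f
  have h3 : Measurable fun p : ℝ × ℝ => slope p.2 f p.1 :=
    (measurable_slope_uncurry hf).comp measurable_swap
  unfold kernel
  fun_prop

theorem aestronglyMeasurable_remainder {f g : ℝ → ℝ} (hf : ContDiff ℝ 2 f)
    (hg : ContDiff ℝ 2 g) (hL : MemLp (deriv g) 2 volume) :
    AEStronglyMeasurable (remainder f g) volume := by
  have h : remainder f g = fun x => 1 / Real.pi * ∫ a, kernel f g x a :=
    funext fun x => remainder_eq hf hg hL x
  rw [h]
  exact ((measurable_kernel hf.continuous.measurable).stronglyMeasurable.integral_prod_right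
    |>.const_mul _).aestronglyMeasurable

/-! ### The near part, `|α| ≤ λ`. -/

/-- The Cauchy-Schwarz inequality, squared. -/
theorem lintegral_mul_sq_le {α : Type*} [MeasurableSpace α] {μ : Measure α} {p q : α → ENNReal}
    (hp : AEMeasurable p μ) (hq : AEMeasurable q μ) :
    (∫⁻ a, p a * q a ∂μ) ^ 2 ≤ (∫⁻ a, p a ^ 2 ∂μ) * ∫⁻ a, q a ^ 2 ∂μ := by
  have h := ENNReal.lintegral_mul_le_Lp_mul_Lq μ Real.HolderConjugate.two_two hp hq
  have h2 := pow_le_pow_left' h 2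
  rw [mul_pow, ← ENNReal.rpow_mul_natCast, ← ENNReal.rpow_mul_natCast] at h2
  simpa using h2

/-- The chord from `x - a` to `x` has the same slope seen from either endpoint. -/
theorem deviation_neg_sub (u : ℝ → ℝ) (a x : ℝ) :
    deriv u (x - a) - slope a u x = -deviation u (-a) (x - a) := by
  have e : slope (-a) u (x - a) = slope a u x := by
    unfold slope
    rw [sub_neg_eq_add, sub_add_cancel, div_neg, ← neg_div, neg_sub]
  rw [deviation, e]
  ring

theorem enorm_kernel_mul_le (f g h : ℝ → ℝ) (x a : ℝ) :
    ‖kernel f g x a‖ₑ * ‖h x‖ₑ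
      ≤ (‖deriv g (x - a) / bracket (deriv f (x - a))‖ₑ * ‖h x / bracket (deriv f x)‖ₑ)
        * (ENNReal.ofReal |a|⁻¹ * (2 * ‖deviation f a x‖ₑ
          * (1 + ‖deviation f (-a) (x - a)‖ₑ))) := by
  have hB := bracket_pos (deriv f x)
  have hC := bracket_pos (deriv f (x - a))
  simp only [Real.enorm_eq_ofReal_abs]
  rw [← ENNReal.ofReal_ofNat 2, ← ENNReal.ofReal_one, ← ENNReal.ofReal_add zero_le_one
    (abs_nonneg _)]
  repeat rw [← ENNReal.ofReal_mul (by positivity)]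
  apply ENNReal.ofReal_le_ofReal
  have key := bracket_mul_abs_saturation_sub_le (slope a f x) (deriv f x) (deriv f (x - a))
  rw [deviation_neg_sub, abs_neg] at key
  change _ ≤ 2 * |deviation f a x| * _ at key
  rw [kernel, abs_mul, abs_div, abs_div, abs_div, abs_of_pos hB, abs_of_pos hC]
  calc |deriv g (x - a)| / |a| * |saturation (slope a f x) - saturation (deriv f x)| * |h x|
      = |deriv g (x - a)| / bracket (deriv f (x - a)) * (|h x| / bracket (deriv f x))
        * (|a|⁻¹ * (bracket (deriv f x) * bracket (deriv f (x - a))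
          * |saturation (slope a f x) - saturation (deriv f x)|)) := by
        field_simp
    _ ≤ _ := by gcongr

/-- The mixed term `8w²z²` is split as `4w⁴ + 4z⁴`, so that only `L²` and `L⁴` norms of deviations
remain. -/
theorem weight_sq_le (a w z : ℝ) :
    (ENNReal.ofReal |a|⁻¹ * (2 * ‖w‖ₑ * (1 + ‖z‖ₑ))) ^ 2
      ≤ ENNReal.ofReal (a ^ 2)⁻¹ * (8 * ‖w‖ₑ ^ 2 + 4 * ‖w‖ₑ ^ 4 + 4 * ‖z‖ₑ ^ 4) := by
  simp only [Real.enorm_eq_ofReal_abs]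
  rw [← ENNReal.ofReal_ofNat 2, ← ENNReal.ofReal_ofNat 8, ← ENNReal.ofReal_ofNat 4,
    ← ENNReal.ofReal_one]
  repeat rw [← ENNReal.ofReal_pow (by positivity)]
  repeat rw [← ENNReal.ofReal_mul (by positivity)]
  repeat rw [← ENNReal.ofReal_add (by positivity) (by positivity)]
  repeat rw [← ENNReal.ofReal_mul (by positivity)]
  rw [← ENNReal.ofReal_pow (by positivity)]
  apply ENNReal.ofReal_le_ofReal
  rw [mul_pow, inv_pow, sq_abs]
  gcongr
  have h1 : (1 + |z|) ^ 2 ≤ 2 + 2 * |z| ^ 2 := by nlinarith [sq_nonneg (1 - |z|)]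
  calc (2 * |w| * (1 + |z|)) ^ 2 = 4 * |w| ^ 2 * (1 + |z|) ^ 2 := by ring
    _ ≤ 4 * |w| ^ 2 * (2 + 2 * |z| ^ 2) := by gcongr
    _ ≤ _ := by nlinarith [sq_nonneg (|w| ^ 2 - |z| ^ 2)]

/-- After enlarging `s` to the whole line, translation invariance decouples the two factors. -/
theorem lintegral_prod_translate_sq (G H : ℝ → ENNReal) (hG : Measurable G) (hH : Measurable H)
    (s : Set ℝ) :
    ∫⁻ x, ∫⁻ a in s, (G (x - a) * H x) ^ 2 ≤ (∫⁻ x, G x ^ 2) * ∫⁻ x, H x ^ 2 := by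
  rw [← lintegral_const_mul _ (hH.pow_const 2)]
  refine lintegral_mono fun x => ?_
  refine (setLIntegral_le_lintegral _ _).trans_eq ?_
  simp_rw [mul_pow]
  rw [lintegral_mul_const _ (by fun_prop), lintegral_sub_left_eq_self (fun y => G y ^ 2) x]

theorem lintegral_weight_sq_le {f : ℝ → ℝ} (hf : Differentiable ℝ f) (hL : MemLp f 2 volume)
    (hE : energy 3 f ≠ ⊤) {lam : ℝ} (hlam : 0 < lam) :
    ∫⁻ x, ∫⁻ a in Set.Icc (-lam) lam, (ENNReal.ofReal |a|⁻¹ * (2 * ‖deviation f a x‖ₑ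
          * (1 + ‖deviation f (-a) (x - a)‖ₑ))) ^ 2
      ≤ ENNReal.ofReal (2 ^ 25) * (1 + energy 3 f) * energyTrunc lam f := by
  have hm := measurable_deviation hf.continuous.measurable
  have hm1 : Measurable fun p : ℝ × ℝ => deviation f p.2 p.1 := hm.comp measurable_swap
  have hm2 : Measurable fun p : ℝ × ℝ => deviation f (-p.2) (p.1 - p.2) :=
    hm.comp (measurable_snd.neg.prodMk (measurable_fst.sub measurable_snd))
  have hm3 : ∀ a, Measurable (deviation f a) := fun a => hm.comp measurable_prodMk_left
  have h1 := setLIntegral_deviation_sq_le hf hL hlam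
  have h2 := setLIntegral_deviation_pow_four_le hf hL hE hlam (σ := 1) (by norm_num)
  have h3 := setLIntegral_deviation_pow_four_le hf hL hE hlam (σ := -1) (by norm_num)
  simp only [one_mul, neg_one_mul] at h2 h3
  rw [lintegral_lintegral_swap (μ := volume) (ν := volume.restrict (Set.Icc (-lam) lam))
    (f := fun x a => (ENNReal.ofReal |a|⁻¹ * (2 * ‖deviation f a x‖ₑ
      * (1 + ‖deviation f (-a) (x - a)‖ₑ))) ^ 2)
    (Measurable.aemeasurable (by unfold Function.uncurry; fun_prop))]
  calc _ ≤ ∫⁻ a in Set.Icc (-lam) lam,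
        (8 * (ENNReal.ofReal (a ^ 2)⁻¹ * ∫⁻ x, ‖deviation f a x‖ₑ ^ 2)
          + 4 * (ENNReal.ofReal (a ^ 2)⁻¹ * ∫⁻ x, ‖deviation f a x‖ₑ ^ 4)
          + 4 * (ENNReal.ofReal (a ^ 2)⁻¹ * ∫⁻ x, ‖deviation f (-a) x‖ₑ ^ 4)) := by
        refine lintegral_mono fun a => ?_
        refine (lintegral_mono fun x => weight_sq_le a _ _).trans_eq ?_
        have := hm3 a
        have := hm3 (-a)
        rw [lintegral_const_mul _ (by fun_prop), lintegral_add_left (by fun_prop),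
          lintegral_add_left (by fun_prop), lintegral_const_mul _ (by fun_prop),
          lintegral_const_mul _ (by fun_prop), lintegral_const_mul _ (by fun_prop),
          lintegral_sub_right_eq_self (fun x => ‖deviation f (-a) x‖ₑ ^ 4) a]
        ring
    _ ≤ 8 * (ENNReal.ofReal 256 * energyTrunc lam f)
          + 4 * (ENNReal.ofReal (2 ^ 22) * energy 3 f * energyTrunc lam f)
          + 4 * (ENNReal.ofReal (2 ^ 22) * energy 3 f * energyTrunc lam f) := by
        have hj : ∀ k : ℕ, ∀ σ : ℝ, Measurable fun a : ℝ =>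
            ENNReal.ofReal (a ^ 2)⁻¹ * ∫⁻ x, ‖deviation f (σ * a) x‖ₑ ^ k := fun k σ => by
          have : Measurable fun p : ℝ × ℝ => ‖deviation f (σ * p.1) p.2‖ₑ ^ k :=
            ((hm.comp ((measurable_fst.const_mul σ).prodMk measurable_snd)).enorm).pow_const k
          have := this.lintegral_prod_right' (ν := volume)
          exact (by fun_prop : Measurable fun a : ℝ => ENNReal.ofReal (a ^ 2)⁻¹).mul this
        have hj1 := hj 2 1
        have hj2 := hj 4 1
        have hj3 := hj 4 (-1)
        simp only [one_mul, neg_one_mul] at hj1 hj2 hj3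
        rw [lintegral_add_left (by fun_prop), lintegral_add_left (by fun_prop),
          lintegral_const_mul _ hj1, lintegral_const_mul _ hj2, lintegral_const_mul _ hj3]
        gcongr
    _ ≤ _ := by
        have e1 : (8 : ENNReal) * ENNReal.ofReal 256 ≤ ENNReal.ofReal (2 ^ 25) := by
          rw [← ENNReal.ofReal_ofNat 8, ← ENNReal.ofReal_mul (by norm_num)]
          exact ENNReal.ofReal_le_ofReal (by norm_num)
        have e2 : (4 : ENNReal) * ENNReal.ofReal (2 ^ 22) + 4 * ENNReal.ofReal (2 ^ 22)
            = ENNReal.ofReal (2 ^ 25) := by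
          rw [← add_mul, show (4 : ENNReal) + 4 = 8 by norm_num, ← ENNReal.ofReal_ofNat 8,
            ← ENNReal.ofReal_mul (by norm_num)]
          norm_num
        calc _ = (8 * ENNReal.ofReal 256) * energyTrunc lam f
            + (4 * ENNReal.ofReal (2 ^ 22) + 4 * ENNReal.ofReal (2 ^ 22))
              * energy 3 f * energyTrunc lam f := by ring
          _ ≤ ENNReal.ofReal (2 ^ 25) * energyTrunc lam f
            + ENNReal.ofReal (2 ^ 25) * energy 3 f * energyTrunc lam f := by
              rw [e2]; gcongr
          _ = _ := by ring

/-- The contribution of the increments of size at most `lam`. -/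
theorem lintegral_near_sq_le {f g h : ℝ → ℝ} (hf : Differentiable ℝ f) (hL : MemLp f 2 volume)
    (hE : energy 3 f ≠ ⊤) (hh : Measurable h) {lam : ℝ} (hlam : 0 < lam) :
    (∫⁻ x, (∫⁻ a in Set.Icc (-lam) lam, ‖kernel f g x a‖ₑ) * ‖h x‖ₑ) ^ 2
      ≤ (∫⁻ x, ‖deriv g x / bracket (deriv f x)‖ₑ ^ 2) * (∫⁻ x, ‖h x / bracket (deriv f x)‖ₑ ^ 2)
        * (ENNReal.ofReal (2 ^ 25) * (1 + energy 3 f) * energyTrunc lam f) := by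
  have hm := measurable_deviation hf.continuous.measurable
  have hm1 : Measurable fun p : ℝ × ℝ => deviation f p.2 p.1 := hm.comp measurable_swap
  have hm2 : Measurable fun p : ℝ × ℝ => deviation f (-p.2) (p.1 - p.2) :=
    hm.comp (measurable_snd.neg.prodMk (measurable_fst.sub measurable_snd))
  have hbr : Measurable bracket := by unfold bracket; fun_prop
  have hdf := measurable_deriv f
  have hdg := measurable_deriv g
  set G : ℝ → ENNReal := fun x => ‖deriv g x / bracket (deriv f x)‖ₑ
  set H : ℝ → ENNReal := fun x => ‖h x / bracket (deriv f x)‖ₑ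
  have hG : Measurable G := by fun_prop
  have hH : Measurable H := by fun_prop
  set p : ℝ × ℝ → ENNReal := fun z => G (z.1 - z.2) * H z.1
  set q : ℝ × ℝ → ENNReal := fun z => ENNReal.ofReal |z.2|⁻¹ * (2 * ‖deviation f z.2 z.1‖ₑ
      * (1 + ‖deviation f (-z.2) (z.1 - z.2)‖ₑ))
  have hp : Measurable p := by fun_prop
  have hq : Measurable q := by fun_prop
  set μ := (volume : Measure ℝ).restrict (Set.Icc (-lam) lam)
  have h1 : ∫⁻ x, (∫⁻ a, ‖kernel f g x a‖ₑ ∂μ) * ‖h x‖ₑ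
      ≤ ∫⁻ z, p z * q z ∂(volume.prod μ) := by
    rw [lintegral_prod (fun z => p z * q z) (hp.mul hq).aemeasurable]
    refine lintegral_mono fun x => ?_
    have hk : Measurable fun a => ‖kernel f g x a‖ₑ :=
      ((measurable_kernel hf.continuous.measurable).comp measurable_prodMk_left).enorm
    rw [← lintegral_mul_const _ hk]
    exact lintegral_mono fun a => enorm_kernel_mul_le f g h x a
  refine (pow_le_pow_left' h1 2).trans ?_
  refine (lintegral_mul_sq_le hp.aemeasurable hq.aemeasurable).trans ?_
  rw [lintegral_prod _ (hp.pow_const 2).aemeasurable, lintegral_prod _ (hq.pow_const 2).aemeasurable]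
  exact mul_le_mul' (lintegral_prod_translate_sq G H hG hH _)
    (lintegral_weight_sq_le hf hL hE hlam)

/-! ### The far part, `|α| > λ`, by integration by parts. -/

/-- The derivative `2uu'` of `u²` is integrable. The resulting bound serves only to justify the
integration by parts; it does not enter the final constant. -/
theorem exists_abs_le_of_memLp {u : ℝ → ℝ} (hu : ContDiff ℝ 1 u) (hL : MemLp u 2 volume)
    (hL' : MemLp (deriv u) 2 volume) : ∃ K : ℝ, 0 ≤ K ∧ ∀ x, |u x| ≤ K := by
  have hint : Integrable fun x => 2 * (u x * deriv u x) :=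
    (MemLp.integrable_mul hL hL').const_mul 2
  have hd : ∀ x, HasDerivAt (fun x => u x ^ 2) (2 * (u x * deriv u x)) x := fun x => by
    convert! ((hu.differentiable one_ne_zero x).hasDerivAt).fun_pow 2 using 1
    simp
    ring
  set M := u 0 ^ 2 + ∫ x, ‖2 * (u x * deriv u x)‖
  have hM : 0 ≤ M := add_nonneg (sq_nonneg _) (integral_nonneg fun _ => norm_nonneg _)
  refine ⟨M + 1, by positivity, fun x => ?_⟩
  have h1 : u x ^ 2 - u 0 ^ 2 = ∫ t in (0 : ℝ)..x, 2 * (u t * deriv u t) :=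
    (intervalIntegral.integral_eq_sub_of_hasDerivAt (fun t _ => hd t)
      hint.intervalIntegrable).symm
  have h2 : ‖∫ t in (0 : ℝ)..x, 2 * (u t * deriv u t)‖ ≤ ∫ x, ‖2 * (u x * deriv u x)‖ :=
    intervalIntegral.norm_integral_le_integral_norm_uIoc.trans
      (setIntegral_le_integral hint.norm (ae_of_all _ fun _ => norm_nonneg _))
  have h3 : u x ^ 2 ≤ M := by
    have := le_abs_self (u x ^ 2 - u 0 ^ 2)
    rw [h1] at this
    rw [Real.norm_eq_abs] at h2
    linarith
  nlinarith [sq_abs (u x), abs_nonneg (u x)]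

theorem hasDerivAt_slope_left {f : ℝ → ℝ} (hf : Differentiable ℝ f) (x : ℝ) {a : ℝ}
    (ha : a ≠ 0) :
    HasDerivAt (fun a => slope a f x) ((deriv f (x - a) - slope a f x) / a) a := by
  have h1 : HasDerivAt (fun a => f (x - a)) (-deriv f (x - a)) a :=
    (hf (x - a)).hasDerivAt.comp_const_sub x a
  convert! (h1.const_sub (f x)).div (hasDerivAt_id a) ha using 1
  simp only [slope, id]
  field_simp

/-- The derivative in `β` of `(saturation (slope (σ β)) - saturation f') / β`. -/
def quotientDeriv (f : ℝ → ℝ) (x a : ℝ) : ℝ :=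
  (2 * slope a f x / (1 + slope a f x ^ 2) ^ 2 * (deriv f (x - a) - slope a f x)
    - (saturation (slope a f x) - saturation (deriv f x))) / a ^ 2

/-- Since `σ² = 1`, the denominators `b²` and `(σb)²` agree, and one formula serves both half-lines.
-/
theorem hasDerivAt_quotient {f : ℝ → ℝ} (hf : Differentiable ℝ f) (x : ℝ) {σ b : ℝ}
    (hσ : σ ^ 2 = 1) (hb : b ≠ 0) :
    HasDerivAt (fun b => (saturation (slope (σ * b) f x) - saturation (deriv f x)) / b)
      (quotientDeriv f x (σ * b)) b := by
  have hσ0 : σ ≠ 0 := by rintro rfl; norm_num at hσ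
  have h1 : HasDerivAt (fun b => slope (σ * b) f x)
      ((deriv f (x - σ * b) - slope (σ * b) f x) / (σ * b) * (σ * 1)) b :=
    (hasDerivAt_slope_left hf x (mul_ne_zero hσ0 hb)).comp b ((hasDerivAt_id b).const_mul σ)
  have h2 := (((hasDerivAt_saturation _).comp b h1).sub_const (saturation (deriv f x))).div
    (hasDerivAt_id b) hb
  convert! h2 using 1
  simp only [quotientDeriv, Function.comp_apply, id, mul_pow, hσ, one_mul, mul_one]
  congr 2
  field_simp

theorem abs_quotientDeriv_le (f : ℝ → ℝ) (x a : ℝ) :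
    |quotientDeriv f x a| ≤ (|deviation f (-a) (x - a)| + |deviation f a x|) * (a ^ 2)⁻¹ := by
  rw [quotientDeriv, abs_div, abs_of_nonneg (sq_nonneg a), div_eq_mul_inv]
  refine mul_le_mul_of_nonneg_right ?_ (by positivity)
  refine (abs_sub _ _).trans (add_le_add ?_ (abs_saturation_slope_sub_le x a))
  rw [deviation_neg_sub, abs_mul, abs_neg]
  exact mul_le_of_le_one_left (abs_nonneg _) (abs_deriv_saturation_le _)

theorem measurable_quotientDeriv {f : ℝ → ℝ} (hf : Measurable f) (x : ℝ) :
    Measurable (quotientDeriv f x) := by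
  have h1 := measurable_slope_left hf x
  have h2 := measurable_deriv f
  unfold quotientDeriv
  fun_prop

/-- A purely qualitative bound: beyond `λ` the slopes are at most `2Kf / λ`, and the remaining
`|f_x|` is dominated by `1 + f_x²`, whose second term is integrable. -/
theorem integrableOn_quotientDeriv_mul {f g : ℝ → ℝ} (hf : Differentiable ℝ f)
    (hL : MemLp (deriv f) 2 volume) {Kf Kg : ℝ} (hKf : ∀ x, |f x| ≤ Kf) (hKg : ∀ x, |g x| ≤ Kg)
    (hg : Measurable g) {σ : ℝ} (hσ : σ ^ 2 = 1) {lam : ℝ} (hlam : 0 < lam) (x : ℝ) :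
    IntegrableOn (fun b => quotientDeriv f x (σ * b) * (g x - g (x - σ * b))) (Set.Ioi lam) := by
  have hσ0 : σ ≠ 0 := by rintro rfl; norm_num at hσ
  have hKf0 : 0 ≤ Kf := (abs_nonneg _).trans (hKf 0)
  have hKg0 : 0 ≤ Kg := (abs_nonneg _).trans (hKg 0)
  have hinv : Integrable fun b : ℝ => (1 + b ^ 2)⁻¹ := integrable_inv_one_add_sq
  have hsq : Integrable fun b => deriv f (x - σ * b) ^ 2 :=
    (hL.integrable_sq.comp_sub_left x).comp_mul_left' hσ0
  refine (((hinv.const_mul ((2 + 2 * Kf / lam) * (1 + (lam ^ 2)⁻¹))).add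
    (hsq.mul_const (lam ^ 2)⁻¹)).mul_const (2 * Kg)).integrableOn.mono' ?_ ?_
  · have := (measurable_quotientDeriv hf.continuous.measurable x).comp (measurable_const_mul σ)
    exact (this.mul (by fun_prop)).aestronglyMeasurable
  · refine (ae_restrict_iff' measurableSet_Ioi).2 (ae_of_all _ fun b (hb : lam < b) => ?_)
    have hb0 : 0 < b := hlam.trans hb
    have h1 : |g x - g (x - σ * b)| ≤ 2 * Kg := by
      refine (abs_sub _ _).trans ?_
      linarith [hKg x, hKg (x - σ * b)]
    have hsb : (σ * b) ^ 2 = b ^ 2 := by rw [mul_pow, hσ, one_mul]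
    have habs : |σ * b| = b := by
      rw [← abs_of_pos hb0, ← sq_eq_sq_iff_abs_eq_abs, abs_of_pos hb0, hsb]
    have hs : |slope (σ * b) f x| ≤ 2 * Kf / lam := by
      rw [slope, abs_div, habs]
      have : |f x - f (x - σ * b)| ≤ 2 * Kf :=
        (abs_sub _ _).trans (by linarith [hKf x, hKf (x - σ * b)])
      gcongr
    have hb1 : (b ^ 2)⁻¹ ≤ (1 + (lam ^ 2)⁻¹) * (1 + b ^ 2)⁻¹ := by
      rw [← div_eq_mul_inv, inv_eq_one_div, div_le_div_iff₀ (by positivity) (by positivity)]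
      have : 1 ≤ (lam ^ 2)⁻¹ * b ^ 2 := by
        rw [← div_eq_inv_mul, one_le_div (by positivity)]
        gcongr
      linarith
    have hb2 : (b ^ 2)⁻¹ ≤ (lam ^ 2)⁻¹ := by gcongr
    have h2 : |quotientDeriv f x (σ * b)|
        ≤ (2 + 2 * Kf / lam + deriv f (x - σ * b) ^ 2) * (b ^ 2)⁻¹ := by
      rw [quotientDeriv, abs_div, hsb, abs_of_pos (by positivity : 0 < b ^ 2), div_eq_mul_inv]
      refine mul_le_mul_of_nonneg_right ?_ (by positivity)
      refine (abs_sub _ _).trans ?_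
      have h3 : |deriv f (x - σ * b) - slope (σ * b) f x|
          ≤ 1 + deriv f (x - σ * b) ^ 2 + 2 * Kf / lam := by
        refine (abs_sub _ _).trans (add_le_add ?_ hs)
        rw [← sq_abs]
        nlinarith [sq_nonneg (|deriv f (x - σ * b)| - 1), abs_nonneg (deriv f (x - σ * b))]
      have h4 := abs_saturation_sub_le_one (slope (σ * b) f x) (deriv f x)
      rw [abs_mul]
      have h5 := mul_le_of_le_one_left (abs_nonneg (deriv f (x - σ * b) - slope (σ * b) f x))
        (abs_deriv_saturation_le (slope (σ * b) f x))
      linarith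
    rw [Real.norm_eq_abs, abs_mul]
    refine mul_le_mul (h2.trans ?_) h1 (abs_nonneg _) (by
      simp only [Pi.add_apply]
      positivity)
    simp only [Pi.add_apply]
    rw [add_mul]
    have h6 : 0 ≤ 2 + 2 * Kf / lam := by positivity
    refine add_le_add ?_ (by gcongr)
    rw [mul_assoc]
    gcongr

theorem integral_Ioi_kernel_eq {f g : ℝ → ℝ} (hf : ContDiff ℝ 2 f) (hg : ContDiff ℝ 2 g)
    (hLf : MemLp f 2 volume) (hLf' : MemLp (deriv f) 2 volume)
    (hLg : MemLp g 2 volume) (hLg' : MemLp (deriv g) 2 volume)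
    {σ : ℝ} (hσ : σ ^ 2 = 1) {lam : ℝ} (hlam : 0 < lam) (x : ℝ) :
    ∫ b in Set.Ioi lam, kernel f g x (σ * b)
      = -((saturation (slope (σ * lam) f x) - saturation (deriv f x)) / lam
          * (g x - g (x - σ * lam)))
        - ∫ b in Set.Ioi lam, quotientDeriv f x (σ * b) * (g x - g (x - σ * b)) := by
  have hσ0 : σ ≠ 0 := by rintro rfl; norm_num at hσ
  have hdf : Differentiable ℝ f := hf.differentiable two_ne_zero
  have hdg : Differentiable ℝ g := hg.differentiable two_ne_zero
  obtain ⟨Kf, hKf0, hKf⟩ := exists_abs_le_of_memLp (hf.of_le one_le_two) hLf hLf'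
  obtain ⟨Kg, hKg0, hKg⟩ := exists_abs_le_of_memLp (hg.of_le one_le_two) hLg hLg'
  set V : ℝ → ℝ := fun b => (saturation (slope (σ * b) f x) - saturation (deriv f x)) / b
  -- Choosing `g x` as the constant of the antiderivative turns it into an increment of `g`, which
  -- is controlled by the `Ḣ^{1/2}` norm.
  set U : ℝ → ℝ := fun b => g x - g (x - σ * b)
  have hV : ∀ b, 0 < b → HasDerivAt V (quotientDeriv f x (σ * b)) b := fun b hb =>
    hasDerivAt_quotient hdf x hσ hb.ne'
  have hU : ∀ b, HasDerivAt U (σ * deriv g (x - σ * b)) b := fun b => by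
    have h1 : HasDerivAt (fun b => x - σ * b) (-(σ * 1)) b :=
      ((hasDerivAt_id b).const_mul σ).const_sub x
    convert! ((hdg (x - σ * b)).hasDerivAt.comp b h1).const_sub (g x) using 1
    ring
  have hk : ∀ b, kernel f g x (σ * b) = V b * (σ * deriv g (x - σ * b)) := fun b => by
    have hi : σ⁻¹ = σ := inv_eq_of_mul_eq_one_right (by rw [← sq]; exact hσ)
    simp only [kernel, V]
    rw [div_eq_mul_inv, mul_inv, hi]
    ring
  have hki : Integrable fun b => kernel f g x (σ * b) :=
    (integrable_kernel hf hg hLg' x).comp_mul_left' hσ0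
  have hVU : Tendsto (V * U) atTop (𝓝 0) := by
    refine squeeze_zero_norm' (a := fun b : ℝ => 2 * Kg * b⁻¹) ?_
      (by simpa using tendsto_inv_atTop_zero.const_mul (2 * Kg))
    filter_upwards [eventually_gt_atTop 0] with b hb
    have h1 : |U b| ≤ 2 * Kg := (abs_sub _ _).trans (by linarith [hKg x, hKg (x - σ * b)])
    have h2 : |V b| ≤ b⁻¹ := by
      simp only [V]
      rw [abs_div, abs_of_pos hb, div_eq_mul_inv]
      exact mul_le_of_le_one_left (by positivity) (abs_saturation_sub_le_one _ _)
    rw [Pi.mul_apply, Real.norm_eq_abs, abs_mul, mul_comm (2 * Kg)]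
    gcongr
  have h0 : Tendsto (V * U) (𝓝[>] lam) (𝓝 (V lam * U lam)) :=
    ((hV lam hlam).continuousAt.mul (hU lam).continuousAt).tendsto.mono_left nhdsWithin_le_nhds
  have := integral_Ioi_mul_deriv_eq_deriv_mul (a := lam) (u := V) (v := U)
    (fun b hb => hV b (hlam.trans hb)) (fun b _ => hU b)
    (by
      refine hki.integrableOn.congr_fun (fun b _ => ?_) measurableSet_Ioi
      exact hk b)
    (integrableOn_quotientDeriv_mul hdf hLf' hKf hKg hg.continuous.measurable hσ hlam x) h0 hVU
  simp only [hk]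
  rw [this]
  ring

/-- The far part of the kernel after an integration by parts. -/
def farBound (f g : ℝ → ℝ) (a x : ℝ) : ENNReal :=
  ‖g x - g (x - a)‖ₑ * ‖deviation f a x‖ₑ

/-- The companion of `farBound` that comes from the derivative of the slope. -/
def farBoundShift (f g : ℝ → ℝ) (a x : ℝ) : ENNReal :=
  ‖g x - g (x - a)‖ₑ * ‖deviation f (-a) (x - a)‖ₑ

theorem enorm_integral_Ioi_kernel_le {f g : ℝ → ℝ} (hf : ContDiff ℝ 2 f) (hg : ContDiff ℝ 2 g)
    (hLf : MemLp f 2 volume) (hLf' : MemLp (deriv f) 2 volume)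
    (hLg : MemLp g 2 volume) (hLg' : MemLp (deriv g) 2 volume)
    {σ : ℝ} (hσ : σ ^ 2 = 1) {lam : ℝ} (hlam : 0 < lam) (x : ℝ) :
    ‖∫ b in Set.Ioi lam, kernel f g x (σ * b)‖ₑ
      ≤ ENNReal.ofReal lam⁻¹ * farBound f g (σ * lam) x
        + ∫⁻ b in Set.Ioi lam, ENNReal.ofReal (b ^ 2)⁻¹
          * (farBoundShift f g (σ * b) x + farBound f g (σ * b) x) := by
  rw [integral_Ioi_kernel_eq hf hg hLf hLf' hLg hLg' hσ hlam x, sub_eq_add_neg]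
  refine (enorm_add_le _ _).trans (add_le_add ?_ ?_)
  · rw [enorm_neg, farBound]
    simp only [Real.enorm_eq_ofReal_abs]
    repeat rw [← ENNReal.ofReal_mul (by positivity)]
    apply ENNReal.ofReal_le_ofReal
    rw [abs_mul, abs_div, abs_of_pos hlam, div_eq_inv_mul, mul_comm |g x - _|, ← mul_assoc]
    exact mul_le_mul_of_nonneg_right (mul_le_mul_of_nonneg_left
      (abs_saturation_slope_sub_le _ _) (by positivity)) (abs_nonneg _)
  · rw [enorm_neg]
    refine (enorm_integral_le_lintegral_enorm _).trans (lintegral_mono fun b => ?_)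
    rw [farBound, farBoundShift]
    simp only [Real.enorm_eq_ofReal_abs]
    repeat rw [← ENNReal.ofReal_mul (by positivity)]
    rw [← ENNReal.ofReal_add (by positivity) (by positivity), ← ENNReal.ofReal_mul (by positivity)]
    apply ENNReal.ofReal_le_ofReal
    have h := abs_quotientDeriv_le f x (σ * b)
    rw [mul_pow, hσ, one_mul] at h
    rw [abs_mul]
    calc _ ≤ _ := mul_le_mul_of_nonneg_right h (abs_nonneg _)
      _ = _ := by ring

/-- Hölder with exponents 4, 4, 2, done as two applications of Cauchy-Schwarz. `S` stands for `‖h‖₂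
‖g‖_{Ḣ^{1/2}} ‖f‖_{Ḣ^{3/2}}`, introduced through its square to avoid roots in `ENNReal`. -/
theorem lintegral_far_le {f g h z : ℝ → ℝ} (hg : Measurable g) (hLg : MemLp g 2 volume)
    (hEg : energy 1 g ≠ ⊤) (hh : Measurable h) (hz : Measurable z) {a : ℝ}
    (hza : ∫⁻ x, ‖z x‖ₑ ^ 4 ≤ ENNReal.ofReal (2 ^ 19 * |a|) * energy 3 f ^ 2)
    {S : ENNReal} (hS : (∫⁻ x, ‖h x‖ₑ ^ 2) * (energy 1 g * energy 3 f) ≤ S ^ 2) :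
    ∫⁻ x, ‖g x - g (x - a)‖ₑ * ‖z x‖ₑ * ‖h x‖ₑ ≤ ENNReal.ofReal (2 ^ 8 * √|a|) * S := by
  have h1 : (∫⁻ x, (‖g x - g (x - a)‖ₑ * ‖z x‖ₑ) ^ 2) ^ 2
      ≤ (ENNReal.ofReal (2 ^ 15 * |a|) * (energy 1 g * energy 3 f)) ^ 2 := by
    simp_rw [mul_pow]
    refine (lintegral_mul_sq_le (by fun_prop) (by fun_prop)).trans ?_
    simp_rw [← pow_mul]
    refine (mul_le_mul' (lintegral_increment_pow_four_le hg hLg hEg a) hza).trans_eq ?_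
    rw [← ENNReal.ofReal_pow (by positivity), show (2 ^ 15 * |a|) ^ 2
      = (2048 * |a|) * (2 ^ 19 * |a|) by ring,
      ENNReal.ofReal_mul (p := 2048 * |a|) (by positivity)]
    ring
  have h2 := (ENNReal.pow_le_pow_left_iff two_ne_zero).1 h1
  have h3 : (∫⁻ x, ‖g x - g (x - a)‖ₑ * ‖z x‖ₑ * ‖h x‖ₑ) ^ 2
      ≤ (ENNReal.ofReal (2 ^ 8 * √|a|) * S) ^ 2 := by
    refine (lintegral_mul_sq_le (by fun_prop) (by fun_prop)).trans ?_
    refine (mul_le_mul' h2 le_rfl).trans ?_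
    rw [mul_pow, ← ENNReal.ofReal_pow (by positivity), mul_assoc, mul_comm (_ * _) (lintegral _ _)]
    -- The constant `2 ^ 15` is rounded up to `2 ^ 16`, the square of `2 ^ 8`.
    refine mul_le_mul' (ENNReal.ofReal_le_ofReal ?_) hS
    rw [mul_pow, Real.sq_sqrt (abs_nonneg a)]
    nlinarith [abs_nonneg a]
  exact (ENNReal.pow_le_pow_left_iff two_ne_zero).1 h3

theorem lintegral_Ioi_inv_sq_mul_sqrt {lam : ℝ} (hlam : 0 < lam) :
    ∫⁻ b in Set.Ioi lam, ENNReal.ofReal ((b ^ 2)⁻¹ * √b) = ENNReal.ofReal (2 / √lam) := by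
  have e : ∀ b ∈ Set.Ioi lam, ENNReal.ofReal ((b ^ 2)⁻¹ * √b)
      = ENNReal.ofReal (b ^ (-(3 / 2) : ℝ)) := fun b hb => by
    have hb0 : 0 < b := hlam.trans hb
    rw [Real.sqrt_eq_rpow, ← Real.rpow_natCast, ← Real.rpow_neg hb0.le, ← Real.rpow_add hb0]
    norm_num
  rw [setLIntegral_congr_fun measurableSet_Ioi e, ← ofReal_integral_eq_lintegral_ofReal
    (integrableOn_Ioi_rpow_of_lt (by norm_num) hlam)
    ((ae_restrict_iff' measurableSet_Ioi).2 (ae_of_all _ fun b hb =>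
      Real.rpow_nonneg (hlam.trans hb).le _)), integral_Ioi_rpow_of_lt (by norm_num) hlam]
  congr 1
  rw [Real.sqrt_eq_rpow, div_eq_mul_inv 2, ← Real.rpow_neg hlam.le]
  norm_num
  ring

theorem lintegral_farBound_mul_le {f g h : ℝ → ℝ} (hf : Differentiable ℝ f)
    (hLf : MemLp f 2 volume) (hEf : energy 3 f ≠ ⊤) (hg : Measurable g) (hLg : MemLp g 2 volume)
    (hEg : energy 1 g ≠ ⊤) (hh : Measurable h) {a : ℝ} (ha : a ≠ 0)
    {S : ENNReal} (hS : (∫⁻ x, ‖h x‖ₑ ^ 2) * (energy 1 g * energy 3 f) ≤ S ^ 2) :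
    ∫⁻ x, farBound f g a x * ‖h x‖ₑ ≤ ENNReal.ofReal (2 ^ 8 * √|a|) * S :=
  lintegral_far_le hg hLg hEg hh
    ((measurable_deviation hf.continuous.measurable).comp measurable_prodMk_left)
    (lintegral_deviation_pow_four_le hf hLf hEf ha) hS

theorem lintegral_farBoundShift_mul_le {f g h : ℝ → ℝ} (hf : Differentiable ℝ f)
    (hLf : MemLp f 2 volume) (hEf : energy 3 f ≠ ⊤) (hg : Measurable g) (hLg : MemLp g 2 volume)
    (hEg : energy 1 g ≠ ⊤) (hh : Measurable h) {a : ℝ} (ha : a ≠ 0)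
    {S : ENNReal} (hS : (∫⁻ x, ‖h x‖ₑ ^ 2) * (energy 1 g * energy 3 f) ≤ S ^ 2) :
    ∫⁻ x, farBoundShift f g a x * ‖h x‖ₑ ≤ ENNReal.ofReal (2 ^ 8 * √|a|) * S := by
  have hm : Measurable (deviation f (-a)) :=
    (measurable_deviation hf.continuous.measurable).comp measurable_prodMk_left
  refine lintegral_far_le hg hLg hEg hh (z := fun x => deviation f (-a) (x - a))
    (hm.comp (measurable_id.sub_const a)) ?_ hS
  rw [lintegral_sub_right_eq_self (fun x => ‖deviation f (-a) x‖ₑ ^ 4) a]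
  simpa using lintegral_deviation_pow_four_le hf hLf hEf (neg_ne_zero.2 ha)

theorem measurable_farBound {f g : ℝ → ℝ} (hf : Measurable f) (hg : Measurable g) :
    Measurable fun p : ℝ × ℝ => farBound f g p.1 p.2 := by
  have := measurable_deviation hf
  unfold farBound
  fun_prop

theorem measurable_farBoundShift {f g : ℝ → ℝ} (hf : Measurable f) (hg : Measurable g) :
    Measurable fun p : ℝ × ℝ => farBoundShift f g p.1 p.2 := by
  have : Measurable fun p : ℝ × ℝ => deviation f (-p.1) (p.2 - p.1) :=
    (measurable_deviation hf).comp (measurable_fst.neg.prodMk (measurable_snd.sub measurable_fst))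
  unfold farBoundShift
  fun_prop

/-- By Tonelli the growth `√b` meets the weight `b⁻²`, and `b^{-3/2}` is integrable at infinity. -/
theorem lintegral_Ioi_inv_sq_mul_le {P : ℝ → ℝ → ENNReal} {k : ℝ → ENNReal} {c lam : ℝ}
    {S : ENNReal} (hP : Measurable fun p : ℝ × ℝ => P p.2 p.1) (hk : Measurable k)
    (hlam : 0 < lam)
    (h : ∀ b, 0 < b → ∫⁻ x, P b x * k x ≤ ENNReal.ofReal (c * √b) * S) :
    ∫⁻ x, (∫⁻ b in Set.Ioi lam, ENNReal.ofReal (b ^ 2)⁻¹ * P b x) * k x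
      ≤ ENNReal.ofReal (2 * c / √lam) * S := by
  have hP1 : ∀ x, Measurable fun b => P b x := fun x => hP.comp measurable_prodMk_left
  calc _ = ∫⁻ x, ∫⁻ b in Set.Ioi lam, ENNReal.ofReal (b ^ 2)⁻¹ * P b x * k x := by
        refine lintegral_congr fun x => ?_
        have := hP1 x
        rw [lintegral_mul_const _ (by fun_prop)]
    _ = ∫⁻ b in Set.Ioi lam, ∫⁻ x, ENNReal.ofReal (b ^ 2)⁻¹ * P b x * k x :=
        lintegral_lintegral_swap (μ := volume) (ν := volume.restrict (Set.Ioi lam))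
          (f := fun x b => ENNReal.ofReal (b ^ 2)⁻¹ * P b x * k x)
          (((by fun_prop : Measurable fun p : ℝ × ℝ => ENNReal.ofReal (p.2 ^ 2)⁻¹).mul hP).mul
            (hk.comp measurable_fst)).aemeasurable
    _ ≤ ∫⁻ b in Set.Ioi lam, ENNReal.ofReal ((b ^ 2)⁻¹ * √b) * (ENNReal.ofReal c * S) := by
        refine setLIntegral_mono (by fun_prop) fun b hb => ?_
        simp_rw [mul_assoc]
        rw [lintegral_const_mul' _ _ ENNReal.ofReal_ne_top]
        refine (mul_le_mul' le_rfl (h b (hlam.trans hb))).trans_eq ?_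
        rw [← mul_assoc, ← mul_assoc, ← ENNReal.ofReal_mul (by positivity),
          ← ENNReal.ofReal_mul (by positivity)]
        congr 2
        ring
    _ = _ := by
        rw [lintegral_mul_const _ (by fun_prop), lintegral_Ioi_inv_sq_mul_sqrt hlam, ← mul_assoc,
          ← ENNReal.ofReal_mul (by positivity)]
        congr 2
        ring

/-- The contribution of the increments of size larger than `lam` and of a given sign. -/
theorem lintegral_far_total_le {f g h : ℝ → ℝ} (hf : ContDiff ℝ 2 f) (hg : ContDiff ℝ 2 g)
    (hLf : MemLp f 2 volume) (hLf' : MemLp (deriv f) 2 volume)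
    (hLg : MemLp g 2 volume) (hLg' : MemLp (deriv g) 2 volume)
    (hEf : energy 3 f ≠ ⊤) (hEg : energy 1 g ≠ ⊤) (hh : Measurable h)
    {S : ENNReal} (hS : (∫⁻ x, ‖h x‖ₑ ^ 2) * (energy 1 g * energy 3 f) ≤ S ^ 2)
    {σ : ℝ} (hσ : σ ^ 2 = 1) {lam : ℝ} (hlam : 0 < lam) :
    ∫⁻ x, ‖∫ b in Set.Ioi lam, kernel f g x (σ * b)‖ₑ * ‖h x‖ₑ
      ≤ ENNReal.ofReal (2 ^ 11 / √lam) * S := by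
  have hσ0 : σ ≠ 0 := by rintro rfl; norm_num at hσ
  have hdf : Differentiable ℝ f := hf.differentiable two_ne_zero
  have habs : ∀ b, 0 < b → |σ * b| = b := fun b hb => by
    rw [← abs_of_pos hb, ← sq_eq_sq_iff_abs_eq_abs, abs_of_pos hb, mul_pow, hσ, one_mul]
  have hP := measurable_farBound hf.continuous.measurable hg.continuous.measurable
  have hQ := measurable_farBoundShift hf.continuous.measurable hg.continuous.measurable
  have hP1 : ∀ a, Measurable (farBound f g a) := fun a => hP.comp measurable_prodMk_left
  have hQ1 : ∀ a, Measurable (farBoundShift f g a) := fun a => hQ.comp measurable_prodMk_left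
  have hP2 : Measurable fun p : ℝ × ℝ => farBound f g (σ * p.2) p.1 :=
    hP.comp ((measurable_snd.const_mul σ).prodMk measurable_fst)
  have hQ2 : Measurable fun p : ℝ × ℝ => farBoundShift f g (σ * p.2) p.1 :=
    hQ.comp ((measurable_snd.const_mul σ).prodMk measurable_fst)
  have hbd : ∀ a : ℝ, a ≠ 0 → _ := fun a ha =>
    lintegral_farBound_mul_le hdf hLf hEf hg.continuous.measurable hLg hEg hh (a := a) ha hS
  have hbs : ∀ a : ℝ, a ≠ 0 → _ := fun a ha =>
    lintegral_farBoundShift_mul_le hdf hLf hEf hg.continuous.measurable hLg hEg hh (a := a) ha hS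
  have hbulk : ∫⁻ x, (∫⁻ b in Set.Ioi lam, ENNReal.ofReal (b ^ 2)⁻¹
      * (farBoundShift f g (σ * b) x + farBound f g (σ * b) x)) * ‖h x‖ₑ
      ≤ ENNReal.ofReal (2 ^ 10 / √lam) * S := by
    refine (lintegral_Ioi_inv_sq_mul_le
      (P := fun b x => farBoundShift f g (σ * b) x + farBound f g (σ * b) x) (c := 2 ^ 9) (S := S)
      (hQ2.add hP2) hh.enorm hlam fun b hb => ?_).trans_eq (by norm_num)
    have h1 := hbd (σ * b) (mul_ne_zero hσ0 hb.ne')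
    have h2 := hbs (σ * b) (mul_ne_zero hσ0 hb.ne')
    rw [habs b hb] at h1 h2
    simp_rw [add_mul]
    have hmq : Measurable fun x => farBoundShift f g (σ * b) x * ‖h x‖ₑ :=
      (hQ1 (σ * b)).mul hh.enorm
    rw [lintegral_add_left hmq]
    refine (add_le_add h2 h1).trans_eq ?_
    rw [← add_mul, ← ENNReal.ofReal_add (by positivity) (by positivity)]
    congr 2
    ring
  have hbdry : ∫⁻ x, ENNReal.ofReal lam⁻¹ * farBound f g (σ * lam) x * ‖h x‖ₑ
      ≤ ENNReal.ofReal (2 ^ 8 / √lam) * S := by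
    have h1 := hbd (σ * lam) (mul_ne_zero hσ0 hlam.ne')
    rw [habs lam hlam] at h1
    simp_rw [mul_assoc]
    rw [lintegral_const_mul' _ _ ENNReal.ofReal_ne_top]
    refine (mul_le_mul' le_rfl h1).trans_eq ?_
    rw [← mul_assoc, ← ENNReal.ofReal_mul (by positivity)]
    congr 2
    have := Real.sq_sqrt hlam.le
    have : 0 < √lam := Real.sqrt_pos.2 hlam
    field_simp
    linarith
  have hmb : Measurable fun x => ENNReal.ofReal lam⁻¹ * farBound f g (σ * lam) x * ‖h x‖ₑ := by
    have := hP1 (σ * lam)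
    fun_prop
  calc _ ≤ ∫⁻ x, (ENNReal.ofReal lam⁻¹ * farBound f g (σ * lam) x * ‖h x‖ₑ
        + (∫⁻ b in Set.Ioi lam, ENNReal.ofReal (b ^ 2)⁻¹
          * (farBoundShift f g (σ * b) x + farBound f g (σ * b) x)) * ‖h x‖ₑ) := by
        refine lintegral_mono fun x => ?_
        rw [← add_mul]
        exact mul_le_mul_left
          (enorm_integral_Ioi_kernel_le hf hg hLf hLf' hLg hLg' hσ hlam x) _
    _ ≤ ENNReal.ofReal (2 ^ 8 / √lam) * S + ENNReal.ofReal (2 ^ 10 / √lam) * S := by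
        rw [lintegral_add_left hmb]
        exact add_le_add hbdry hbulk
    _ ≤ _ := by
        rw [← add_mul, ← ENNReal.ofReal_add (by positivity) (by positivity), ← add_div]
        gcongr
        norm_num

/-! ### Comparison with the norms of the statement, and assembly. -/

theorem enorm_remainder_le {f g : ℝ → ℝ} (hf : ContDiff ℝ 2 f) (hg : ContDiff ℝ 2 g)
    (hLg' : MemLp (deriv g) 2 volume) {lam : ℝ} (hlam : 0 < lam) (x : ℝ) :
    ‖remainder f g x‖ₑ ≤ (∫⁻ a in Set.Icc (-lam) lam, ‖kernel f g x a‖ₑ)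
      + (‖∫ b in Set.Ioi lam, kernel f g x (1 * b)‖ₑ
        + ‖∫ b in Set.Ioi lam, kernel f g x (-1 * b)‖ₑ) := by
  have hk := integrable_kernel hf hg hLg' x
  have e : ∫ a, kernel f g x a = (∫ a in Set.Ioc (-lam) lam, kernel f g x a)
      + ((∫ b in Set.Ioi lam, kernel f g x (1 * b))
        + ∫ b in Set.Ioi lam, kernel f g x (-1 * b)) := by
    simp only [one_mul, neg_one_mul]
    rw [integral_comp_neg_Ioi lam (kernel f g x), ← integral_add_compl
      (measurableSet_Iic (a := -lam)) hk, Set.compl_Iic,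
      ← Set.Ioc_union_Ioi_eq_Ioi (by linarith : -lam ≤ lam),
      setIntegral_union (Set.Ioc_disjoint_Ioi le_rfl) measurableSet_Ioi hk.integrableOn
        hk.integrableOn]
    ring
  have hpi : ‖(1 / Real.pi : ℝ)‖ₑ ≤ 1 := by
    rw [Real.enorm_eq_ofReal_abs, ← ENNReal.ofReal_one, abs_of_pos (by positivity)]
    refine ENNReal.ofReal_le_ofReal ?_
    rw [div_le_one Real.pi_pos]
    linarith [Real.pi_gt_three]
  rw [remainder_eq hf hg hLg' x, enorm_mul, e]
  refine (mul_le_of_le_one_left zero_le hpi).trans ?_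
  refine (enorm_add_le _ _).trans (add_le_add ?_ (enorm_add_le _ _))
  exact (enorm_integral_le_lintegral_enorm _).trans
    (lintegral_mono_set Set.Ioc_subset_Icc_self)

theorem integrable_abs_pow_mul {f : ℝ → ℝ} (hf : MemH (3 / 2) f) {k : ℕ} (hk : k ≤ 3) :
    Integrable fun ξ : ℝ => |ξ| ^ k * ‖fourierL2 f ξ‖ ^ 2 := by
  have hm := measurable_fourierL2 f
  refine hf.2.mono' (by fun_prop) (ae_of_all _ fun ξ => ?_)
  rw [Real.norm_eq_abs, abs_of_nonneg (by positivity)]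
  refine mul_le_mul_of_nonneg_right ?_ (by positivity)
  rw [show (2 * (3 / 2) : ℝ) = (3 : ℕ) by norm_num, Real.rpow_natCast]
  calc |ξ| ^ k ≤ (1 + |ξ|) ^ k := by gcongr; linarith
    _ ≤ (1 + |ξ|) ^ 3 := pow_le_pow_right₀ (by linarith [abs_nonneg ξ]) hk

theorem ofReal_mul_density {c : ℝ} (hc : 0 ≤ c) (u : ℝ → ℝ) (ξ : ℝ) :
    ENNReal.ofReal c * density u ξ
      = ENNReal.ofReal ((2 * Real.pi)⁻¹ * (c * ‖fourierL2 u ξ‖ ^ 2)) := by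
  rw [density, ← ofReal_norm, ← ENNReal.ofReal_pow (norm_nonneg _),
    ← ENNReal.ofReal_mul (by positivity), ← ENNReal.ofReal_mul hc]
  congr 1
  ring

theorem energy_eq {f : ℝ → ℝ} (hf : MemH (3 / 2) f) {k : ℕ} (hk : k ≤ 3) {σ : ℝ}
    (hσ : 2 * σ = k) : energy k f = ENNReal.ofReal (homNorm σ f ^ 2) := by
  have hi := (integrable_abs_pow_mul hf hk).const_mul (2 * Real.pi)⁻¹
  rw [homNorm, hσ, Real.sq_sqrt (by positivity), ← integral_const_mul, energy]
  simp only [Real.rpow_natCast]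
  rw [ofReal_integral_eq_lintegral_ofReal hi (ae_of_all _ fun ξ => by positivity)]
  exact lintegral_congr fun ξ => ofReal_mul_density (by positivity) f ξ

theorem energy_ne_top {f : ℝ → ℝ} (hf : MemH (3 / 2) f) {k : ℕ} (hk : k ≤ 3) :
    energy k f ≠ ⊤ := by
  rw [energy_eq hf hk (σ := k / 2) (by ring)]
  exact ENNReal.ofReal_ne_top

/-- There is room in two places: `t ≤ t^{1/100}` on `[0, 1]`, and the factor `1 / 2π` is in the
density but not in the truncated norm. -/
theorem energyTrunc_le {f : ℝ → ℝ} (hf : MemH (3 / 2) f) {lam : ℝ} (hlam : 0 < lam) :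
    energyTrunc lam f ≤ ENNReal.ofReal (homNormTrunc lam f ^ 2) := by
  have hm := measurable_fourierL2 f
  have hmin : ∀ ξ : ℝ, 0 ≤ min (lam * |ξ|) 1 := fun ξ => le_min (by positivity) zero_le_one
  have hle : ∀ ξ : ℝ, min (lam * |ξ|) 1 ≤ min (lam * |ξ|) 1 ^ (1 / 100 : ℝ) := fun ξ =>
    Real.self_le_rpow_of_le_one (hmin ξ) (min_le_right _ _) (by norm_num)
  have hnn : ∀ ξ : ℝ, 0 ≤ min (lam * |ξ|) 1 ^ (1 / 100 : ℝ) * |ξ| ^ 3 * ‖fourierL2 f ξ‖ ^ 2 :=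
    fun ξ => by
      have := Real.rpow_nonneg (hmin ξ) (1 / 100 : ℝ)
      positivity
  have hi : Integrable fun ξ : ℝ =>
      min (lam * |ξ|) 1 ^ (1 / 100 : ℝ) * |ξ| ^ 3 * ‖fourierL2 f ξ‖ ^ 2 := by
    refine (integrable_abs_pow_mul hf le_rfl).mono' (by fun_prop) (ae_of_all _ fun ξ => ?_)
    rw [Real.norm_eq_abs, abs_of_nonneg (hnn ξ), mul_assoc]
    exact mul_le_of_le_one_left (by positivity)
      (Real.rpow_le_one (hmin ξ) (min_le_right _ _) (by norm_num))
  rw [homNormTrunc, Real.sq_sqrt (integral_nonneg hnn),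
    ofReal_integral_eq_lintegral_ofReal hi (ae_of_all _ hnn), energyTrunc]
  refine lintegral_mono fun ξ => ?_
  have := hmin ξ
  rw [ofReal_mul_density (by positivity)]
  refine ENNReal.ofReal_le_ofReal ?_
  have hpi : (2 * Real.pi)⁻¹ ≤ 1 := inv_le_one_of_one_le₀ (by linarith [Real.pi_gt_three])
  refine (mul_le_of_le_one_left (by positivity) hpi).trans ?_
  rw [mul_comm (|ξ| ^ 3)]
  gcongr
  exact hle ξ

theorem memLp_deriv {f : ℝ → ℝ} (hd : Differentiable ℝ f) (hf : MemH (3 / 2) f) :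
    MemLp (deriv f) 2 volume := by
  refine ⟨(measurable_deriv f).aestronglyMeasurable, ?_⟩
  rw [eLpNorm_lt_top_iff_lintegral_rpow_enorm_lt_top two_ne_zero ENNReal.ofNat_ne_top]
  have h := (spectrallyBounded_deriv hd hf.1).sq_le
  have e : ∫⁻ ξ, ENNReal.ofReal (ξ ^ 2) * density f ξ = energy 2 f := by
    simp only [energy, sq_abs]
  rw [e] at h
  simpa using h.trans_lt (energy_ne_top hf (by norm_num)).lt_top

theorem lintegral_enorm_sq_eq {u : ℝ → ℝ} (hu : MemLp u 2 volume) :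
    ∫⁻ x, ‖u x‖ₑ ^ 2 = ENNReal.ofReal (normL2 u ^ 2) := by
  rw [normL2, ENNReal.ofReal_pow ENNReal.toReal_nonneg, ENNReal.ofReal_toReal hu.eLpNorm_ne_top,
    eLpNorm_eq_lintegral_rpow_enorm_toReal two_ne_zero ENNReal.ofNat_ne_top,
    ← ENNReal.rpow_natCast, ← ENNReal.rpow_mul]
  simp

theorem memLp_div_bracket {u f : ℝ → ℝ} (hu : MemLp u 2 volume) :
    MemLp (fun x => u x / bracket (deriv f x)) 2 volume := by
  have hbr : Measurable bracket := by unfold bracket; fun_prop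
  have hdf := measurable_deriv f
  have hm : Measurable fun x => bracket (deriv f x) := by fun_prop
  refine hu.of_le (hu.1.aemeasurable.div hm.aemeasurable).aestronglyMeasurable (ae_of_all _ fun x => ?_)
  rw [norm_div, Real.norm_of_nonneg (bracket_pos _).le]
  exact div_le_self (norm_nonneg _) (one_le_bracket _)

theorem lintegral_remainder_mul_le {f g h : ℝ → ℝ} {lam : ℝ} (hlam : 0 < lam)
    (hf : ContDiff ℝ 2 f) (hHf : MemH (3 / 2) f) (hg : ContDiff ℝ 2 g) (hHg : MemH (3 / 2) g)
    (hh : Measurable h) (hL : MemLp h 2 volume) :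
    ∫⁻ x, ‖remainder f g x * h x‖ₑ ≤ ENNReal.ofReal
      (2 ^ 13 * ((1 + homNorm (3 / 2) f ^ 2) * homNormTrunc lam f
                * normL2 (fun x => deriv g x / bracket (deriv f x))
                * normL2 (fun x => h x / bracket (deriv f x))
              + 1 / Real.sqrt lam * homNorm (1 / 2) g * homNorm (3 / 2) f * normL2 h)) := by
  have hdf : Differentiable ℝ f := hf.differentiable two_ne_zero
  have hdg : Differentiable ℝ g := hg.differentiable two_ne_zero
  have hLf' := memLp_deriv hdf hHf
  have hLg' := memLp_deriv hdg hHg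
  have hEf : energy 3 f ≠ ⊤ := energy_ne_top hHf le_rfl
  have hEg : energy 1 g ≠ ⊤ := energy_ne_top hHg (by norm_num)
  have eA : energy 3 f = ENNReal.ofReal (homNorm (3 / 2) f ^ 2) :=
    energy_eq hHf le_rfl (by norm_num)
  have eB : energy 1 g = ENNReal.ofReal (homNorm (1 / 2) g ^ 2) :=
    energy_eq hHg (by norm_num) (by norm_num)
  have hA0 : 0 ≤ homNorm (3 / 2) f := Real.sqrt_nonneg _
  have hB0 : 0 ≤ homNorm (1 / 2) g := Real.sqrt_nonneg _
  have hT0 : 0 ≤ homNormTrunc lam f := Real.sqrt_nonneg _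
  have hG0 : 0 ≤ normL2 (fun x => deriv g x / bracket (deriv f x)) := ENNReal.toReal_nonneg
  have hH0 : 0 ≤ normL2 (fun x => h x / bracket (deriv f x)) := ENNReal.toReal_nonneg
  have hh0 : 0 ≤ normL2 h := ENNReal.toReal_nonneg
  have hT := energyTrunc_le hHf hlam
  have eG := lintegral_enorm_sq_eq (memLp_div_bracket (f := f) hLg')
  have eH := lintegral_enorm_sq_eq (memLp_div_bracket (f := f) hL)
  have eh := lintegral_enorm_sq_eq hL
  have hnear := lintegral_near_sq_le (g := g) hdf hHf.1 hEf hh hlam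
  rw [eG, eH, eA] at hnear
  generalize homNorm (3 / 2) f = A at *
  generalize homNorm (1 / 2) g = B at *
  generalize homNormTrunc lam f = T at *
  generalize normL2 (fun x => deriv g x / bracket (deriv f x)) = G at *
  generalize normL2 (fun x => h x / bracket (deriv f x)) = H at *
  generalize normL2 h = Z at *
  set S : ENNReal := ENNReal.ofReal (Z * (B * A)) with hS
  have hSle : (∫⁻ x, ‖h x‖ₑ ^ 2) * (energy 1 g * energy 3 f) ≤ S ^ 2 := by
    rw [eh, eA, eB, hS, ← ENNReal.ofReal_pow (by positivity), mul_pow, mul_pow,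
      ← ENNReal.ofReal_mul (by positivity), ← ENNReal.ofReal_mul (by positivity)]
  have hfar : ∀ σ : ℝ, σ ^ 2 = 1 → _ := fun σ hσ =>
    lintegral_far_total_le hf hg hHf.1 hLf' hHg.1 hLg' hEf hEg hh hSle (σ := σ) hσ hlam
  have hnear' : ∫⁻ x, (∫⁻ a in Set.Icc (-lam) lam, ‖kernel f g x a‖ₑ) * ‖h x‖ₑ
      ≤ ENNReal.ofReal (2 ^ 13 * ((1 + A ^ 2) * T * G * H)) := by
    refine (ENNReal.pow_le_pow_left_iff two_ne_zero).1 (hnear.trans ?_)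
    refine (mul_le_mul' le_rfl (mul_le_mul' le_rfl hT)).trans ?_
    rw [← ENNReal.ofReal_one, ← ENNReal.ofReal_add zero_le_one (by positivity)]
    repeat rw [← ENNReal.ofReal_mul (by positivity)]
    rw [← ENNReal.ofReal_pow (by positivity)]
    refine ENNReal.ofReal_le_ofReal ?_
    -- Cauchy-Schwarz gives only the square root of `1 + A²`, so the first power has room to spare;
    -- `2 ^ 25` is raised to `2 ^ 26` to have an exact root.
    have h1 : (1 + A ^ 2) ≤ (1 + A ^ 2) ^ 2 := by nlinarith [sq_nonneg A]
    calc G ^ 2 * H ^ 2 * (2 ^ 25 * (1 + A ^ 2) * T ^ 2)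
        ≤ G ^ 2 * H ^ 2 * (2 ^ 26 * (1 + A ^ 2) ^ 2 * T ^ 2) := by
          gcongr <;> norm_num
      _ = _ := by ring
  have hmk := measurable_kernel (g := g) hf.continuous.measurable
  have hm1 : Measurable fun x => (∫⁻ a in Set.Icc (-lam) lam, ‖kernel f g x a‖ₑ) * ‖h x‖ₑ :=
    (hmk.enorm.lintegral_prod_right' (ν := volume.restrict (Set.Icc (-lam) lam))).mul hh.enorm
  have hm2 : Measurable fun x => ‖∫ b in Set.Ioi lam, kernel f g x (1 * b)‖ₑ * ‖h x‖ₑ := by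
    have : Measurable fun p : ℝ × ℝ => kernel f g p.1 (1 * p.2) :=
      hmk.comp (measurable_fst.prodMk (measurable_snd.const_mul 1))
    exact (this.stronglyMeasurable.integral_prod_right
      (ν := volume.restrict (Set.Ioi lam))).measurable.enorm.mul hh.enorm
  calc ∫⁻ x, ‖remainder f g x * h x‖ₑ
      ≤ ∫⁻ x, ((∫⁻ a in Set.Icc (-lam) lam, ‖kernel f g x a‖ₑ) * ‖h x‖ₑ
        + (‖∫ b in Set.Ioi lam, kernel f g x (1 * b)‖ₑ * ‖h x‖ₑ
          + ‖∫ b in Set.Ioi lam, kernel f g x (-1 * b)‖ₑ * ‖h x‖ₑ)) := by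
        refine lintegral_mono fun x => ?_
        rw [enorm_mul, ← add_mul, ← add_mul]
        exact mul_le_mul_left (enorm_remainder_le hf hg hLg' hlam x) _
    _ ≤ ENNReal.ofReal (2 ^ 13 * ((1 + A ^ 2) * T * G * H))
        + (ENNReal.ofReal (2 ^ 11 / √lam) * S + ENNReal.ofReal (2 ^ 11 / √lam) * S) := by
        rw [lintegral_add_left hm1, lintegral_add_left hm2]
        exact add_le_add hnear' (add_le_add (hfar 1 (by norm_num)) (hfar (-1) (by norm_num)))
    _ ≤ _ := by
        rw [hS, ← ENNReal.ofReal_mul (by positivity), ← ENNReal.ofReal_add (by positivity)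
          (by positivity), ← ENNReal.ofReal_add (by positivity) (by positivity)]
        refine ENNReal.ofReal_le_ofReal ?_
        have : 0 ≤ 1 / √lam * B * A * Z := by positivity
        have e : 2 ^ 11 / √lam * (Z * (B * A)) = 2 ^ 11 * (1 / √lam * B * A * Z) := by ring
        rw [e]
        linarith

end Muskat

end

theorem proposition5p6 :
    ∃ C : ℝ, 0 < C ∧ ∀ (lam : ℝ), 0 < lam → ∀ (f g h : ℝ → ℝ),
      ContDiff ℝ ∞ f → Muskat.MemH (3 / 2) f →
      ContDiff ℝ ∞ g → Muskat.MemH (3 / 2) g →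
      MemLp h 2 volume →
        (∀ x : ℝ, Muskat.RemainderConverges f g x) ∧
        Integrable (fun x => Muskat.remainder f g x * h x) volume ∧
        |∫ x, Muskat.remainder f g x * h x| ≤
          C * ((1 + Muskat.homNorm (3 / 2) f ^ 2) * Muskat.homNormTrunc lam f
                * Muskat.normL2 (fun x => deriv g x / Muskat.bracket (deriv f x))
                * Muskat.normL2 (fun x => h x / Muskat.bracket (deriv f x))
              + 1 / Real.sqrt lam * Muskat.homNorm (1 / 2) g * Muskat.homNorm (3 / 2) f
                * Muskat.normL2 h) := by
  refine ⟨2 ^ 13, by norm_num, fun lam hlam f g h hf hHf hg hHg hL => ?_⟩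
  have hf2 : ContDiff ℝ 2 f := contDiff_infty.1 hf 2
  have hg2 : ContDiff ℝ 2 g := contDiff_infty.1 hg 2
  have hLg' := Muskat.memLp_deriv (hg2.differentiable two_ne_zero) hHg
  -- The Tonelli arguments use a measurable `h`, so `h` is replaced by a representative; both sides
  -- depend only on its almost everywhere class.
  obtain ⟨k, hk, hkh⟩ := hL.1
  have hLk : MemLp k 2 volume := hL.ae_eq hkh
  have key := Muskat.lintegral_remainder_mul_le hlam hf2 hHf hg2 hHg hk.measurable hLk
  have e1 : ∫⁻ x, ‖Muskat.remainder f g x * k x‖ₑ = ∫⁻ x, ‖Muskat.remainder f g x * h x‖ₑ :=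
    lintegral_congr_ae (hkh.mono fun x hx => by simp only [hx])
  have e2 : Muskat.normL2 k = Muskat.normL2 h := by
    rw [Muskat.normL2, Muskat.normL2, eLpNorm_congr_ae hkh]
  have e3 : Muskat.normL2 (fun x => k x / Muskat.bracket (deriv f x))
      = Muskat.normL2 (fun x => h x / Muskat.bracket (deriv f x)) := by
    rw [Muskat.normL2, Muskat.normL2]
    congr 1
    exact eLpNorm_congr_ae (hkh.mono fun x hx => by simp only [hx])
  rw [e1, e2, e3] at key
  have hint : Integrable (fun x => Muskat.remainder f g x * h x) volume :=
    ⟨(Muskat.aestronglyMeasurable_remainder hf2 hg2 hLg').mul hL.1,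
      key.trans_lt ENNReal.ofReal_lt_top⟩
  refine ⟨Muskat.remainderConverges hf2 hg2 hLg', hint, ?_⟩
  rw [← Real.norm_eq_abs]
  refine (norm_integral_le_integral_norm _).trans ?_
  rw [integral_norm_eq_lintegral_enorm hint.1]
  refine ENNReal.toReal_le_of_le_ofReal ?_ key
  have h1 : 0 ≤ Muskat.homNorm (3 / 2) f := Real.sqrt_nonneg _
  have h2 : 0 ≤ Muskat.homNorm (1 / 2) g := Real.sqrt_nonneg _
  have h3 : 0 ≤ Muskat.homNormTrunc lam f := Real.sqrt_nonneg _
  have h4 : 0 ≤ Muskat.normL2 (fun x => deriv g x / Muskat.bracket (deriv f x)) :=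
    ENNReal.toReal_nonneg
  have h5 : 0 ≤ Muskat.normL2 (fun x => h x / Muskat.bracket (deriv f x)) :=
    ENNReal.toReal_nonneg
  have h6 : 0 ≤ Muskat.normL2 h := ENNReal.toReal_nonneg
  positivity
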